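/- Let $G,c>0$ and $N\ge 0$. Let $\Omega_{1},\dots,\Omega_{N}\subset\mathbb{R}^3$ be nonempty bounded connected open sets with smooth boundary (the bodies), each lying locally on one side of its boundary. For each $\alpha$ let $\epsilon_{\alpha}>0$ be an integrable function on $\Omega_\alpha$ (the energy density) and let $\sigma_{\alpha}$ be a symmetric $3\times 3$ tensor field, of class $C^1$ in $\Omega_\alpha$ and continuous on $\overline{\Omega_\alpha}$ (the Cauchy stress). Let $U:\mathbb{R}^3\to\mathbb{R}$ be of class $C^1$. Suppose that these data solve the equations of Giulini's nonlinear modification of Newtonian gravity, that is, $$\Delta U=\frac{4\pi G}{c^2}\sum_{\alpha}\epsilon_{\alpha}\,\chi_{\Omega_\alpha}-\frac{1}{2c^2}\,|\partial U|^2\quad\text{on }\mathbb{R}^3\text{ in the sense of distributions},\qquad U(x)\to 0\ \text{ as }|x|\to\infty,$$ and, for every $\alpha$ and every $i$, $$e^{-U/c^2}\,\partial^j\!\left(e^{U/c^2}\sigma_{\alpha\,ij}\right)=\frac{1}{c^2}\,\epsilon_{\alpha}\,\partial_iU\ \text{ in }\Omega_\alpha,\qquad \sigma_{\alpha\,i}{}^{j}\,\nu_j=0\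 \text{ on }\partial\Omega_\alpha,$$ where $\nu$ is the outward unit normal of $\Omega_\alpha$. Suppose further that there is a plane $S\subset\mathbb{R}^3$ with unit normal $n$, disjoint from every $\Omega_\alpha$, such that $\partial_nU=0$ at every point of $S$. Then the solution is trivial: there are no bodies ($N=0$) and $U=0$ on all of $\mathbb{R}^3$. -/

import Mathlib

open scoped ContDiff Laplacian

noncomputable section

namespace Giulini

/-- Three-dimensional Euclidean space. -/
abbrev E3 : Type := EuclideanSpace ℝ (Fin 3)

/-- The partial derivative `∂ᵢ f` at `x`. -/
def pderiv (i : Fin 3) (f : E3 → ℝ) (x : E3) : ℝ :=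
  fderiv ℝ f x (EuclideanSpace.single i (1 : ℝ))

/-- `ρ` is a smooth local defining function of the open set `Ω` near `p`: in an open neighbourhood
`V` of `p` on which `ρ` is smooth, `Ω` is the set `{ρ < 0}`, and `∇ρ(p) ≠ 0`. -/
def IsLocalDefiningFunction (Ω : Set E3) (p : E3) (ρ : E3 → ℝ) : Prop :=
  ∃ V : Set E3, IsOpen V ∧ p ∈ V ∧ ContDiffOn ℝ ∞ ρ V ∧
    (∀ x ∈ V, x ∈ Ω ↔ ρ x < 0) ∧ gradient ρ p ≠ 0

/-- `Ω` has a smooth boundary (and lies locally on one side of it). -/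
def HasSmoothBoundary (Ω : Set E3) : Prop :=
  ∀ p ∈ frontier Ω, ∃ ρ : E3 → ℝ, IsLocalDefiningFunction Ω p ρ

/-- `ν` is the outward unit normal of `Ω` at the boundary point `p`. -/
def IsOutwardUnitNormal (Ω : Set E3) (p ν : E3) : Prop :=
  p ∈ frontier Ω ∧
    ∃ ρ : E3 → ℝ, IsLocalDefiningFunction Ω p ρ ∧ ν = ‖gradient ρ p‖⁻¹ • gradient ρ p

/-- The regions occupied by bodies: (nonempty) bounded open connected sets with smooth boundary. -/
structure IsBody (Ω : Set E3) : Prop where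
  isOpen : IsOpen Ω
  isBounded : Bornology.IsBounded Ω
  isConnected : IsConnected Ω
  smoothBoundary : HasSmoothBoundary Ω

/-- The field equation
`ΔU = (4πG/c²) ∑ₐ εₐ χ_{Ωₐ} - (1/(2c²)) |∂U|²` on `ℝ³` in the sense of distributions. -/
def FieldEquation (G c : ℝ) {N : ℕ} (Ω : Fin N → Set E3) (ε : Fin N → E3 → ℝ)
    (U : E3 → ℝ) : Prop :=
  ∀ φ : E3 → ℝ, ContDiff ℝ ∞ φ → HasCompactSupport φ →
    ∫ x, U x * (Δ φ) x =
      ∫ x, (4 * Real.pi * G / c ^ 2 * (∑ α, (Ω α).indicator (ε α) x)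
        - 1 / (2 * c ^ 2) * ‖gradient U x‖ ^ 2) * φ x

/-- The matter equations of one body `Ω` with energy density `ε` and Cauchy stress `σ`:
`e^{-U/c²} ∂ʲ(e^{U/c²} σᵢⱼ) = (1/c²) ε ∂ᵢU` in `Ω`, and `σᵢʲ νⱼ = 0` on the boundary.
Here `σ` is symmetric, `C¹` in `Ω` and continuous on the closure. -/
structure MatterEquations (c : ℝ) (U : E3 → ℝ) (Ω : Set E3) (ε : E3 → ℝ)
    (σ : E3 → Matrix (Fin 3) (Fin 3) ℝ) : Prop where
  symm : ∀ x ∈ closure Ω, (σ x).IsSymm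
  contDiffOn : ∀ i j, ContDiffOn ℝ 1 (fun x => σ x i j) Ω
  continuousOn : ∀ i j, ContinuousOn (fun x => σ x i j) (closure Ω)
  balance : ∀ x ∈ Ω, ∀ i,
    Real.exp (-(U x / c ^ 2)) *
        ∑ j, pderiv j (fun y => Real.exp (U y / c ^ 2) * σ y i j) x
      = 1 / c ^ 2 * ε x * pderiv i U x
  traction : ∀ p ν, IsOutwardUnitNormal Ω p ν → ∀ i, ∑ j, σ p i j * ν j = 0

/-- A solution of Giulini's theory with `N` bodies `Ωₐ` of positive energy densities `εₐ` and
Cauchy stresses `σₐ`, and with the potential `U`, which is `C¹` and tends to `0` at infinity. -/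
structure IsSolution (G c : ℝ) {N : ℕ} (Ω : Fin N → Set E3) (ε : Fin N → E3 → ℝ)
    (σ : Fin N → E3 → Matrix (Fin 3) (Fin 3) ℝ) (U : E3 → ℝ) : Prop where
  isBody : ∀ α, IsBody (Ω α)
  density_pos : ∀ α, ∀ x ∈ Ω α, 0 < ε α x
  density_integrable : ∀ α, MeasureTheory.IntegrableOn (ε α) (Ω α)
  contDiff : ContDiff ℝ 1 U
  tendsto_zero : Filter.Tendsto U (Filter.cocompact E3) (nhds 0)
  field : FieldEquation G c Ω ε U
  matter : ∀ α, MatterEquations c U (Ω α) (ε α) (σ α)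

/-- The plane through `a` with normal vector `n`. -/
def plane (a n : E3) : Set E3 := {x | inner ℝ n (x - a) = 0}

end Giulini

end

/-!
A change of variable makes the field equation linear: `ψ = exp (U / (2c²))` solves
`Δψ = (2πG/c⁴) ε ψ` with `ψ → 1` at infinity, and the balance law of a body says that the force
density `ε ψ ∇ψ` is the divergence of the rescaled stress `exp (U / c²) σ`, up to a constant. As
the traction vanishes on the boundary, the total force on every body is zero
(`IsSolution.integral_force_eq_zero`). A body is connected and misses the plane `S`, so the force
on the matter on one side of `S` is zero as well.

On the other hand `Δψ ∇ψ = div (∇ψ ⊗ ∇ψ - ½ |∇ψ|² I)`. Integrated over a half-space bounded by `S`,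
the normal component of this identity expresses the force as an integral over `S`, where
`∂ₙψ = 0` leaves only `-½ ∫ |∇ψ|²`; the contribution of the sphere at infinity vanishes by
Caccioppoli's inequality, in dimension three. Hence `∇ψ = 0` on `S`
(`IsWeakPoisson.gradient_eq_zero_on_plane`), so `ψ` is constant on `S`, and the constant is `1`.
Now `1 - ψ`, restricted to one side of `S` and extended by zero, is of class `C¹`, weakly
superharmonic on the whole space, and zero at infinity. By the strong minimum principle
(`eq_zero_of_superharmonic`) it vanishes. So `ψ = 1`, that is `U = 0`, and then the source, which
is positive on the bodies, must be absent.

Since `U` is only `C¹` and `ε` only integrable, every identity is used in weak form with `C¹` test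
functions (`weak_identity_of_smooth`), and surface integrals are replaced by integrals against
the gradients of smooth cutoff functions. The stress identity is proved without second derivatives
by testing with difference quotients of `ψ` (`IsWeakPoisson.stress_identity`). The divergence
theorem for vector fields that are merely continuous up to a smooth boundary is proved directly,
with cutoff functions built from local defining functions (`integral_divergence_eq_zero`).
-/

noncomputable section

open scoped ContDiff Laplacian Gradient Topology Convolution
open MeasureTheory Filter Set

namespace Giulini

/-! ### Calculus with `C¹` test functions -/

section Calculus

set_option linter.unusedSectionVars false

variable {E : Type*} [NormedAddCommGroup E] [InnerProductSpace ℝ E] [FiniteDimensional ℝ E]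

theorem continuous_gradient {f : E → ℝ} (hf : ContDiff ℝ 1 f) : Continuous (gradient f) :=
  (InnerProductSpace.toDual ℝ E).symm.continuous.comp (hf.continuous_fderiv (by simp))

theorem continuous_fderiv_gradient {f g : E → ℝ} (hf : ContDiff ℝ 1 f) (hg : ContDiff ℝ 1 g) :
    Continuous fun x => fderiv ℝ f x (gradient g x) :=
  (hf.continuous_fderiv (by simp)).clm_apply (continuous_gradient hg)

theorem continuous_fderiv_const {f : E → ℝ} (hf : ContDiff ℝ 1 f) (v : E) :
    Continuous fun x => fderiv ℝ f x v :=
  (hf.continuous_fderiv (by simp)).clm_apply continuous_const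

theorem fderiv_gradient_self (f : E → ℝ) (x : E) :
    fderiv ℝ f x (gradient f x) = ‖gradient f x‖ ^ 2 := by
  rw [← inner_gradient_left, real_inner_self_eq_norm_sq]

theorem fderiv_gradient_comm (f g : E → ℝ) (x : E) :
    fderiv ℝ f x (gradient g x) = fderiv ℝ g x (gradient f x) := by
  rw [← inner_gradient_left, ← inner_gradient_left, real_inner_comm]

theorem norm_fderiv_eq_norm_gradient (f : E → ℝ) (x : E) : ‖fderiv ℝ f x‖ = ‖gradient f x‖ := by
  rw [← toDual_gradient, LinearIsometryEquiv.norm_map]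

theorem fderiv_eq_zero_of_notMem_tsupport {f : E → ℝ} {x : E} (hx : x ∉ tsupport f) :
    fderiv ℝ f x = 0 :=
  image_eq_zero_of_notMem_tsupport fun h => hx (tsupport_fderiv_subset ℝ h)

theorem exists_pos_bound_on_compact {X : Type*} [TopologicalSpace X] {K : Set X}
    (hK : IsCompact K) {f : X → ℝ} (hf : ContinuousOn f K) : ∃ C, 0 < C ∧ ∀ x ∈ K, |f x| ≤ C := by
  obtain ⟨C, hC⟩ := hK.exists_bound_of_continuousOn hf
  exact ⟨max C 1, by positivity, fun x hx => (hC x hx).trans (le_max_left _ _)⟩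

variable [MeasurableSpace E] [BorelSpace E]

theorem integral_fderiv_apply_eq_zero {f : E → ℝ} (hf : ContDiff ℝ 1 f) (hc : HasCompactSupport f)
    (v : E) : ∫ x, fderiv ℝ f x v = 0 := by
  have h := integral_mul_fderiv_eq_neg_fderiv_mul_of_integrable (μ := (volume : Measure E))
    (f := fun _ : E => (1 : ℝ)) (g := f) (v := v) (by simp)
    (by
      simp only [one_mul]
      exact (continuous_fderiv_const hf v).integrable_of_hasCompactSupport
        (hc.fderiv_apply (𝕜 := ℝ) v))
    (by simpa using hf.continuous.integrable_of_hasCompactSupport hc)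
    (fun x _ => by fun_prop) (fun x _ => (hf.differentiable (by simp)).differentiableAt)
  simpa using h

theorem integral_mul_fderiv_eq_neg {f g : E → ℝ} (hf : ContDiff ℝ 1 f) (hg : ContDiff ℝ 1 g)
    (hc : HasCompactSupport g) (v : E) :
    ∫ x, f x * fderiv ℝ g x v = -∫ x, g x * fderiv ℝ f x v := by
  have h := integral_fderiv_apply_eq_zero (f := fun y => f y * g y) (hf.mul hg) hc.mul_left v
  have e : ∀ x, fderiv ℝ (fun y => f y * g y) x v
      = f x * fderiv ℝ g x v + g x * fderiv ℝ f x v := by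
    intro x
    rw [fderiv_fun_mul (hf.differentiable (by simp) x) (hg.differentiable (by simp) x)]
    simp
  simp only [e] at h
  rw [integral_add] at h
  · linarith
  · exact (hf.continuous.mul (continuous_fderiv_const hg v)).integrable_of_hasCompactSupport
      (hc.fderiv_apply (𝕜 := ℝ) v).mul_left
  · exact (hg.continuous.mul (continuous_fderiv_const hf v)).integrable_of_hasCompactSupport
      hc.mul_right

/-- Mollification of a `C¹` function with compact support: smooth functions, supported in a common
compact set, that converge to it uniformly together with their first derivatives. -/
theorem exists_smooth_approx {χ : E → ℝ} (hχ : ContDiff ℝ 1 χ) (hc : HasCompactSupport χ) :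
    ∃ φ : ℕ → E → ℝ, (∀ k, ContDiff ℝ ∞ (φ k)) ∧
      (∀ k x, x ∉ Metric.cthickening 1 (tsupport χ) → φ k x = 0) ∧
      (∀ k, HasCompactSupport (φ k)) ∧
      (∀ k x v, |fderiv ℝ (φ k) x v - fderiv ℝ χ x v| ≤ ‖v‖) ∧
      (∀ x v, Tendsto (fun k => fderiv ℝ (φ k) x v) atTop (𝓝 (fderiv ℝ χ x v))) ∧
      (∀ k x, |φ k x - χ x| ≤ 1) ∧
      (∀ x, Tendsto (fun k => φ k x) atTop (𝓝 (χ x))) := by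
  have hU : UniformContinuous χ := hc.uniformContinuous_of_continuous hχ.continuous
  have hDc : HasCompactSupport (fderiv ℝ χ) := hc.fderiv (𝕜 := ℝ)
  have hDcont := hχ.continuous_fderiv (n := 1) (by simp)
  have hU' : UniformContinuous (fderiv ℝ χ) := hDc.uniformContinuous_of_continuous hDcont
  -- the radius at which `χ` and its derivative oscillate by at most `1 / (k + 1)`
  have hr : ∀ k : ℕ, ∃ r : ℝ, 0 < r ∧ r ≤ 1 ∧
      (∀ x y, dist x y < r → dist (χ x) (χ y) ≤ 1 / ((k : ℝ) + 1)) ∧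
      (∀ x y, dist x y < r → dist (fderiv ℝ χ x) (fderiv ℝ χ y) ≤ 1 / ((k : ℝ) + 1)) := by
    intro k
    obtain ⟨r₁, h₁, H₁⟩ := Metric.uniformContinuous_iff.1 hU (1 / ((k : ℝ) + 1)) (by positivity)
    obtain ⟨r₂, h₂, H₂⟩ := Metric.uniformContinuous_iff.1 hU' (1 / ((k : ℝ) + 1)) (by positivity)
    refine ⟨min 1 (min r₁ r₂), by positivity, min_le_left _ _, fun x y h => ?_, fun x y h => ?_⟩
    · exact (H₁ (h.trans_le ((min_le_right _ _).trans (min_le_left _ _)))).le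
    · exact (H₂ (h.trans_le ((min_le_right _ _).trans (min_le_right _ _)))).le
  choose r r0 r1 hr₁ hr₂ using hr
  let b : ℕ → ContDiffBump (0 : E) := fun k => ⟨r k / 2, r k, by have := r0 k; linarith,
    by have := r0 k; linarith⟩
  let φ : ℕ → E → ℝ := fun k =>
    (b k).normed volume ⋆[ContinuousLinearMap.lsmul ℝ ℝ, volume] χ
  have hli : ∀ k, LocallyIntegrable ((b k).normed (volume : Measure E)) volume := fun k =>
    (b k).continuous_normed.locallyIntegrable
  have hφ : ∀ k x, |φ k x - χ x| ≤ 1 / ((k : ℝ) + 1) := fun k x => by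
    have := (b k).dist_normed_convolution_le (μ := (volume : Measure E)) (x₀ := x)
      hχ.continuous.aestronglyMeasurable (fun y hy => hr₁ k y x hy)
    rwa [Real.dist_eq] at this
  have hder : ∀ k x v, |fderiv ℝ (φ k) x v - fderiv ℝ χ x v| ≤ 1 / ((k : ℝ) + 1) * ‖v‖ := by
    intro k x v
    have h1 := hc.hasFDerivAt_convolution_right (ContinuousLinearMap.lsmul ℝ ℝ) (hli k) hχ x
    have h2 := (b k).dist_normed_convolution_le (μ := (volume : Measure E)) (x₀ := x)
      (g := fun y => fderiv ℝ χ y) hDcont.aestronglyMeasurable (fun y hy => hr₂ k y x hy)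
    rw [h1.fderiv]
    have h3 : ((b k).normed volume ⋆[(ContinuousLinearMap.lsmul ℝ ℝ).precompR E, volume]
        fderiv ℝ χ) x
        = ((b k).normed volume ⋆[ContinuousLinearMap.lsmul ℝ ℝ, volume] fderiv ℝ χ) x := by
      simp only [convolution_def]
      congr 1
    rw [h3, ← Real.norm_eq_abs, ← sub_apply]
    refine (ContinuousLinearMap.le_opNorm _ _).trans ?_
    rw [dist_eq_norm] at h2
    gcongr
  have h0 : ∀ k x, x ∉ Metric.cthickening 1 (tsupport χ) → φ k x = 0 := by
    intro k x hx
    have hz : ∀ y, dist y x ≤ 1 → χ y = 0 := by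
      intro y hy
      by_contra hne
      refine hx (Metric.mem_cthickening_of_dist_le x y 1 _ (subset_tsupport _ hne) ?_)
      rwa [dist_comm]
    have := (b k).dist_normed_convolution_le (μ := (volume : Measure E)) (x₀ := x) (ε := 0)
      hχ.continuous.aestronglyMeasurable (fun y hy => by
        rw [hz y ((le_of_lt hy).trans (r1 k)), hz x (by simp)]; simp)
    rw [hz x (by simp)] at this
    exact dist_le_zero.1 this
  have hle : ∀ k : ℕ, 1 / ((k : ℝ) + 1) ≤ 1 := fun k => by
    rw [div_le_one (by positivity)]; linarith [Nat.cast_nonneg (α := ℝ) k]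
  refine ⟨φ, fun k => ?_, h0, fun k => ?_, fun k x v => ?_, fun x v => ?_, fun k x => ?_,
    fun x => ?_⟩
  · exact (b k).hasCompactSupport_normed.contDiff_convolution_left _ (b k).contDiff_normed
      hχ.continuous.locallyIntegrable
  · exact HasCompactSupport.intro (hc.isCompact.cthickening) (h0 k)
  · refine (hder k x v).trans ?_
    nlinarith [hle k, norm_nonneg v]
  · have hz : Tendsto (fun k : ℕ => 1 / ((k : ℝ) + 1) * ‖v‖) atTop (𝓝 0) := by
      simpa using (tendsto_one_div_add_atTop_nhds_zero_nat (𝕜 := ℝ)).mul_const ‖v‖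
    rw [tendsto_iff_dist_tendsto_zero]
    exact squeeze_zero (fun _ => dist_nonneg) (fun k => hder k x v) hz
  · exact (hφ k x).trans (hle k)
  · rw [tendsto_iff_dist_tendsto_zero]
    exact squeeze_zero (fun _ => dist_nonneg) (fun k => hφ k x)
      tendsto_one_div_add_atTop_nhds_zero_nat

/-- A first-order linear identity that holds for smooth test functions holds for `C¹` ones. -/
theorem weak_identity_of_smooth {X : E → E} {f : E → ℝ} (hX : Continuous X)
    (hf : LocallyIntegrable f)
    (h : ∀ φ : E → ℝ, ContDiff ℝ ∞ φ → HasCompactSupport φ →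
      ∫ x, fderiv ℝ φ x (X x) = ∫ x, f x * φ x)
    {χ : E → ℝ} (hχ : ContDiff ℝ 1 χ) (hc : HasCompactSupport χ) :
    ∫ x, fderiv ℝ χ x (X x) = ∫ x, f x * χ x := by
  obtain ⟨φ, hsm, h0, hcs, hd, hdt, hv, hvt⟩ := exists_smooth_approx hχ hc
  set K := Metric.cthickening 1 (tsupport χ) with hK
  have hKc : IsCompact K := hc.isCompact.cthickening
  have hKcl : IsClosed K := hKc.isClosed
  have hd0 : ∀ k x, x ∉ K → fderiv ℝ (φ k) x = 0 := by
    intro k x hx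
    have : φ k =ᶠ[𝓝 x] fun _ => 0 := by
      filter_upwards [hKcl.isOpen_compl.mem_nhds hx] with y hy using h0 k y hy
    rw [this.fderiv_eq]; simp
  have hfK : IntegrableOn f K := hf.integrableOn_isCompact hKc
  obtain ⟨C, C0, hC⟩ := exists_pos_bound_on_compact hKc hχ.continuous.continuousOn
  have hgc : Continuous fun x => |fderiv ℝ χ x (X x)| + ‖X x‖ :=
    (((hχ.continuous_fderiv (by simp)).clm_apply hX).abs).add hX.norm
  have t1 : Tendsto (fun k => ∫ x, fderiv ℝ (φ k) x (X x)) atTop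
      (𝓝 (∫ x, fderiv ℝ χ x (X x))) := by
    refine tendsto_integral_of_dominated_convergence
      (K.indicator fun x => |fderiv ℝ χ x (X x)| + ‖X x‖) (fun k => ?_) ?_ (fun k => ?_) ?_
    · exact (((hsm k).continuous_fderiv (by simp)).clm_apply hX).aestronglyMeasurable
    · exact (hgc.continuousOn.integrableOn_compact hKc).integrable_indicator hKcl.measurableSet
    · refine Eventually.of_forall fun x => ?_
      by_cases hx : x ∈ K
      · rw [indicator_of_mem hx, Real.norm_eq_abs]
        have := hd k x (X x)
        have := abs_sub_abs_le_abs_sub (fderiv ℝ (φ k) x (X x)) (fderiv ℝ χ x (X x))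
        linarith
      · simp [hd0 k x hx, indicator_of_notMem hx]
    · exact Eventually.of_forall fun x => hdt x (X x)
  have t2 : Tendsto (fun k => ∫ x, f x * φ k x) atTop (𝓝 (∫ x, f x * χ x)) := by
    refine tendsto_integral_of_dominated_convergence
      (K.indicator fun x => |f x| * (C + 1)) (fun k => ?_) ?_ (fun k => ?_) ?_
    · exact hf.aestronglyMeasurable.mul (hsm k).continuous.aestronglyMeasurable
    · exact IntegrableOn.integrable_indicator (hfK.abs.mul_const _) hKcl.measurableSet
    · refine Eventually.of_forall fun x => ?_
      by_cases hx : x ∈ K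
      · rw [indicator_of_mem hx, Real.norm_eq_abs, abs_mul]
        have := hv k x
        have := abs_sub_abs_le_abs_sub (φ k x) (χ x)
        have := hC x hx
        gcongr
        linarith
      · simp [h0 k x hx, indicator_of_notMem hx]
    · exact Eventually.of_forall fun x => (hvt x).const_mul _
  refine tendsto_nhds_unique t1 ?_
  simpa only [h _ (hsm _) (hcs _)] using t2

end Calculus

/-! ### The weak Poisson equation and its stress identity -/

section Poisson
set_option linter.unusedSectionVars false
variable {E : Type*} [NormedAddCommGroup E] [InnerProductSpace ℝ E] [FiniteDimensional ℝ E]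
  [MeasurableSpace E] [BorelSpace E]

/-- `ψ` solves `Δψ = m` weakly, tested against `C¹` functions of compact support. The pairing
`⟨∇χ, ∇ψ⟩` is written as the derivative of `χ` in the direction `∇ψ`. -/
def IsWeakPoisson (ψ m : E → ℝ) : Prop :=
  ∀ χ : E → ℝ, ContDiff ℝ 1 χ → HasCompactSupport χ →
    ∫ x, fderiv ℝ χ x (gradient ψ x) = -∫ x, m x * χ x

theorem hasDerivAt_line {f : E → ℝ} (hf : ContDiff ℝ 1 f) (x v : E) :
    HasDerivAt (fun t : ℝ => f (x + t • v)) (fderiv ℝ f x v) 0 := by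
  have h1 : HasFDerivAt f (fderiv ℝ f x) (x + (0 : ℝ) • v) := by
    simpa using (hf.differentiable (by simp) x).hasFDerivAt
  have h2 : HasDerivAt (fun t : ℝ => x + t • v) v 0 := by
    simpa using ((hasDerivAt_id (0 : ℝ)).smul_const v).const_add x
  exact h1.comp_hasDerivAt 0 h2

theorem tendsto_symmetric_quotient {f : E → ℝ} (hf : ContDiff ℝ 1 f) (x v : E) :
    Tendsto (fun h : ℝ => (f (x + h • v) - f (x - h • v)) / (2 * h)) (𝓝[≠] 0)
      (𝓝 (fderiv ℝ f x v)) := by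
  have h1 := (hasDerivAt_line hf x v).sub (hasDerivAt_line hf x (-v))
  have h2 := (hasDerivAt_iff_tendsto_slope.1 h1).div_const 2
  convert h2 using 2 with h
  · simp [slope_def_field, sub_eq_add_neg]
    ring
  · simp

theorem tendsto_forward_quotient {f : E → ℝ} (hf : ContDiff ℝ 1 f) (x v : E) :
    Tendsto (fun h : ℝ => (f x - f (x + h • v)) / (2 * h)) (𝓝[≠] 0)
      (𝓝 (-(1 / 2) * fderiv ℝ f x v)) := by
  have h2 := (hasDerivAt_iff_tendsto_slope.1 (hasDerivAt_line hf x v)).const_mul (-(1 / 2))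
  convert h2 using 2 with h
  simp [slope_def_field]
  ring

/-- The identity `div (∇ψ ⊗ ∇ψ - ½ |∇ψ|² I) = Δψ ∇ψ` in weak form, for `ψ` merely of class `C¹`.
The test function is `g` times the symmetric difference quotient of `ψ` in the direction `v`;
translation invariance of the integral moves the difference quotient of the quadratic term
`⟨∇ψ(x + hv), ∇ψ(x)⟩` onto `g`, so that no second derivative of `ψ` is needed. -/
theorem IsWeakPoisson.stress_identity {ψ m : E → ℝ} (hw : IsWeakPoisson ψ m)
    (hψ : ContDiff ℝ 1 ψ) (hm : LocallyIntegrable m) {g : E → ℝ} (hg : ContDiff ℝ 1 g)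
    (hc : HasCompactSupport g) (v : E) :
    ∫ x, (fderiv ℝ g x (gradient ψ x) * fderiv ℝ ψ x v
        - 1 / 2 * ‖gradient ψ x‖ ^ 2 * fderiv ℝ g x v)
      = -∫ x, m x * (g x * fderiv ℝ ψ x v) := by
  let D : ℝ → E → ℝ := fun h x => (ψ (x + h • v) - ψ (x - h • v)) / (2 * h)
  let a : ℝ → E → ℝ := fun h x => inner ℝ (gradient ψ (x + h • v)) (gradient ψ x)
  let Q : ℝ → E → ℝ := fun h x => (g x - g (x + h • v)) / (2 * h)
  have hG := continuous_gradient hψ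
  have hac : ∀ h, Continuous (a h) := fun h =>
    (hG.comp (continuous_id.add continuous_const)).inner hG
  have hsh : ∀ h : ℝ, ContDiff ℝ 1 fun x => ψ (x + h • v) := fun h =>
    hψ.comp (contDiff_id.add contDiff_const)
  have hsh' : ∀ h : ℝ, ContDiff ℝ 1 fun x => ψ (x - h • v) := fun h =>
    hψ.comp (contDiff_id.sub contDiff_const)
  have hD : ∀ h, ContDiff ℝ 1 (D h) := fun h => ((hsh h).sub (hsh' h)).div_const _
  have hDg := continuous_fderiv_gradient hg hψ
  have hgsh : ∀ h : ℝ, Continuous fun x => g (x + h • v) := fun h =>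
    hg.continuous.comp (continuous_id.add continuous_const)
  have hgshc : ∀ h : ℝ, HasCompactSupport fun x => g (x + h • v) := fun h =>
    hc.comp_homeomorph (Homeomorph.addRight (h • v))
  have hDgc : HasCompactSupport fun x => fderiv ℝ g x (gradient ψ x) := by
    refine (hc.fderiv (𝕜 := ℝ)).mono fun x hx hx' => hx ?_
    simp [hx']
  -- the weak equation tested with `g * D h`
  have key : ∀ h : ℝ,
      ∫ x, (fderiv ℝ g x (gradient ψ x) * D h x + a h x * Q h x)
        = -∫ x, m x * (g x * D h x) := by
    intro h
    rw [← hw (fun y => g y * D h y) (hg.mul (hD h)) hc.mul_right]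
    have e : ∀ x, fderiv ℝ (fun y => g y * D h y) x (gradient ψ x)
        = fderiv ℝ g x (gradient ψ x) * D h x
          + (g x * a h x / (2 * h) - g x * a h (x - h • v) / (2 * h)) := by
      intro x
      rw [fderiv_fun_mul (hg.differentiable (by simp) x) ((hD h).differentiable (by simp) x)]
      have e1 : fderiv ℝ (D h) x
          = (2 * h)⁻¹ • (fderiv ℝ ψ (x + h • v) - fderiv ℝ ψ (x - h • v)) := by
        have d1 := (hsh h).differentiable (by simp) x
        have d2 := (hsh' h).differentiable (by simp) x
        have e3 : D h = fun x => (2 * h)⁻¹ * (ψ (x + h • v) - ψ (x - h • v)) := by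
          funext y; simp only [D]; ring
        rw [e3, fderiv_const_mul (d1.fun_sub d2), fderiv_fun_sub d1 d2, fderiv_comp_add_right,
          fderiv_comp_sub]
      have e2 : a h (x - h • v) = fderiv ℝ ψ (x - h • v) (gradient ψ x) := by
        simp only [a, sub_add_cancel]
        rw [real_inner_comm, inner_gradient_left]
      have e4 : a h x = fderiv ℝ ψ (x + h • v) (gradient ψ x) := by
        simp only [a]; rw [inner_gradient_left]
      simp only [e1, e2, e4, add_apply, smul_apply, sub_apply, smul_eq_mul]
      ring
    simp only [e]
    have i1 : Integrable fun x => fderiv ℝ g x (gradient ψ x) * D h x :=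
      (hDg.mul (hD h).continuous).integrable_of_hasCompactSupport hDgc.mul_right
    have i2 : Integrable fun x => g x * a h x / (2 * h) :=
      ((hg.continuous.mul (hac h)).integrable_of_hasCompactSupport hc.mul_right).div_const _
    have i3 : Integrable fun x => g (x + h • v) * a h x / (2 * h) :=
      (((hgsh h).mul (hac h)).integrable_of_hasCompactSupport (hgshc h).mul_right).div_const _
    have i3' : Integrable fun x => g x * a h (x - h • v) / (2 * h) := by
      have := i3.comp_sub_right (h • v)
      simpa only [sub_add_cancel] using this
    have t : ∫ x, g x * a h (x - h • v) / (2 * h) = ∫ x, g (x + h • v) * a h x / (2 * h) := by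
      rw [← integral_add_right_eq_self _ (h • v)]
      simp only [add_sub_cancel_right]
    have e5 : ∀ x, a h x * Q h x
        = g x * a h x / (2 * h) - g (x + h • v) * a h x / (2 * h) := by
      intro x; simp only [Q]; ring
    simp only [e5]
    have j : Integrable fun x => g x * a h x / (2 * h) - g (x + h • v) * a h x / (2 * h) :=
      i2.sub i3
    have j' : Integrable fun x => g x * a h x / (2 * h) - g x * a h (x - h • v) / (2 * h) :=
      i2.sub i3'
    rw [integral_add i1 j, integral_sub i2 i3, integral_add i1 j',
      integral_sub i2 i3', t]
  -- bounds for `D h`, `Q h` and `a h` that are uniform in `|h| ≤ 1`, for dominated convergence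
  obtain ⟨R, R0, hR⟩ := hc.isCompact.isBounded.subset_closedBall_lt 0 0
  have hgR : ∀ x, x ∉ Metric.closedBall (0 : E) R → g x = 0 := fun x hx =>
    image_eq_zero_of_notMem_tsupport fun h => hx (hR h)
  set B := Metric.closedBall (0 : E) (R + 2 * ‖v‖) with hB
  have hBc : IsCompact B := isCompact_closedBall _ _
  obtain ⟨C, C0, hC⟩ := exists_pos_bound_on_compact hBc hG.norm.continuousOn
  have hC : ∀ x ∈ B, ‖gradient ψ x‖ ≤ C := fun x hx => by simpa using hC x hx
  obtain ⟨L, hL⟩ := ContDiff.lipschitzWith_of_hasCompactSupport hc hg (by simp)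
  have hhv : ∀ h : ℝ, |h| ≤ 1 → ‖h • v‖ ≤ ‖v‖ := fun h hh => by
    rw [norm_smul, Real.norm_eq_abs]; nlinarith [norm_nonneg v]
  have hDb : ∀ h : ℝ, h ≠ 0 → |h| ≤ 1 → ∀ x ∈ Metric.closedBall (0 : E) R,
      |D h x| ≤ C * ‖v‖ := by
    intro h h0 hh x hx
    have hx' : ‖x‖ ≤ R := by simpa using hx
    have hv := hhv h hh
    have m1 : x + h • v ∈ B := by
      rw [hB, mem_closedBall_zero_iff]
      refine (norm_add_le _ _).trans ?_
      linarith [norm_nonneg v]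
    have m2 : x - h • v ∈ B := by
      rw [hB, mem_closedBall_zero_iff]
      refine (norm_sub_le _ _).trans ?_
      linarith [norm_nonneg v]
    have := (convex_closedBall (0 : E) (R + 2 * ‖v‖)).norm_image_sub_le_of_norm_fderiv_le
      (𝕜 := ℝ) (f := ψ) (C := C) (fun y _ => hψ.differentiable (by simp) y)
      (fun y hy => by rw [norm_fderiv_eq_norm_gradient]; exact hC y hy) m2 m1
    have e : x + h • v - (x - h • v) = (2 * h) • v := by rw [two_mul, add_smul]; abel
    rw [e, norm_smul, Real.norm_eq_abs, Real.norm_eq_abs] at this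
    simp only [D]
    rw [abs_div, div_le_iff₀ (by positivity)]
    linarith
  have hQb : ∀ h : ℝ, h ≠ 0 → |h| ≤ 1 → ∀ x, |Q h x| ≤ L * ‖v‖ := by
    intro h h0 hh x
    have := hL.dist_le_mul x (x + h • v)
    rw [dist_eq_norm, dist_eq_norm, Real.norm_eq_abs] at this
    have e : x - (x + h • v) = -(h • v) := by abel
    rw [e, norm_neg, norm_smul, Real.norm_eq_abs] at this
    simp only [Q]
    rw [abs_div, div_le_iff₀ (by positivity), abs_mul, abs_two]
    have : 0 ≤ L * ‖v‖ * |h| := by positivity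
    nlinarith
  have hQ0 : ∀ h : ℝ, |h| ≤ 1 → ∀ x, x ∉ Metric.closedBall (0 : E) (R + ‖v‖) → Q h x = 0 := by
    intro h hh x hx
    have hx' : R + ‖v‖ < ‖x‖ := by simpa using hx
    have hv := hhv h hh
    have z1 : g x = 0 := hgR x (by simp; linarith [norm_nonneg v])
    have z2 : g (x + h • v) = 0 := by
      refine hgR _ ?_
      have := norm_sub_le (x + h • v) (h • v)
      rw [add_sub_cancel_right] at this
      simp; linarith
    simp [Q, z1, z2]
  have hab : ∀ h : ℝ, |h| ≤ 1 → ∀ x ∈ Metric.closedBall (0 : E) (R + ‖v‖), |a h x| ≤ C * C := by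
    intro h hh x hx
    have hx' : ‖x‖ ≤ R + ‖v‖ := by simpa using hx
    have hv := hhv h hh
    have m1 : x + h • v ∈ B := by
      rw [hB, mem_closedBall_zero_iff]
      refine (norm_add_le _ _).trans ?_
      linarith [norm_nonneg v]
    have m2 : x ∈ B := by
      rw [hB, mem_closedBall_zero_iff]; linarith [norm_nonneg v]
    refine (abs_real_inner_le_norm _ _).trans ?_
    exact mul_le_mul (hC _ m1) (hC _ m2) (norm_nonneg _) C0.le
  have hsmall : ∀ᶠ h : ℝ in 𝓝[≠] 0, h ≠ 0 ∧ |h| ≤ 1 := by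
    refine (eventually_mem_nhdsWithin).and (mem_nhdsWithin_of_mem_nhds ?_)
    have : Metric.closedBall (0 : ℝ) 1 ∈ 𝓝 (0 : ℝ) := Metric.closedBall_mem_nhds _ one_pos
    filter_upwards [this] with h hh using by simpa using hh
  have hgd : ∀ x, x ∉ Metric.closedBall (0 : E) R → fderiv ℝ g x = 0 := fun x hx =>
    fderiv_eq_zero_of_notMem_tsupport fun h => hx (hR h)
  -- `D h → ∂ᵥψ`, `Q h → -½ ∂ᵥg` and `a h → |∇ψ|²` as `h → 0`
  have t1 : Tendsto (fun h : ℝ => ∫ x, (fderiv ℝ g x (gradient ψ x) * D h x + a h x * Q h x))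
      (𝓝[≠] 0) (𝓝 (∫ x, (fderiv ℝ g x (gradient ψ x) * fderiv ℝ ψ x v
        - 1 / 2 * ‖gradient ψ x‖ ^ 2 * fderiv ℝ g x v))) := by
    refine tendsto_integral_filter_of_dominated_convergence
      (fun x => |fderiv ℝ g x (gradient ψ x)| * (C * ‖v‖)
        + (Metric.closedBall (0 : E) (R + ‖v‖)).indicator (fun _ => C * C * (L * ‖v‖)) x)
      ?_ ?_ ?_ ?_
    · refine Eventually.of_forall fun h => Continuous.aestronglyMeasurable ?_
      exact (hDg.mul (hD h).continuous).add
        ((hac h).mul ((hg.continuous.sub (hgsh h)).div_const _))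
    · filter_upwards [hsmall] with h hh
      refine Eventually.of_forall fun x => ?_
      rw [Real.norm_eq_abs]
      refine (abs_add_le _ _).trans (add_le_add ?_ ?_)
      · rw [abs_mul]
        by_cases hx : x ∈ Metric.closedBall (0 : E) R
        · exact mul_le_mul_of_nonneg_left (hDb h hh.1 hh.2 x hx) (abs_nonneg _)
        · simp [hgd x hx]
      · by_cases hx : x ∈ Metric.closedBall (0 : E) (R + ‖v‖)
        · rw [indicator_of_mem hx, abs_mul]
          exact mul_le_mul (hab h hh.2 x hx) (hQb h hh.1 hh.2 x) (abs_nonneg _) (by positivity)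
        · rw [indicator_of_notMem hx, hQ0 h hh.2 x hx]; simp
    · refine ((hDg.integrable_of_hasCompactSupport hDgc).abs.mul_const _).add ?_
      exact (integrable_indicator_iff measurableSet_closedBall).2
        (integrableOn_const measure_closedBall_lt_top.ne)
    · refine Eventually.of_forall fun x => ?_
      have l1 : Tendsto (fun h => D h x) (𝓝[≠] 0) (𝓝 (fderiv ℝ ψ x v)) :=
        tendsto_symmetric_quotient hψ x v
      have l2 : Tendsto (fun h => Q h x) (𝓝[≠] 0) (𝓝 (-(1 / 2) * fderiv ℝ g x v)) :=
        tendsto_forward_quotient hg x v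
      have l3 : Tendsto (fun h => a h x) (𝓝[≠] 0) (𝓝 (‖gradient ψ x‖ ^ 2)) := by
        have : Continuous fun h : ℝ => a h x :=
          (hG.comp (continuous_const.add (continuous_id.smul continuous_const))).inner
            continuous_const
        have := (this.tendsto 0).mono_left (nhdsWithin_le_nhds (s := {0}ᶜ))
        simpa [a, fderiv_gradient_self] using this
      have := (l1.const_mul (fderiv ℝ g x (gradient ψ x))).add (l3.mul l2)
      convert this using 2
      ring
  have t2 : Tendsto (fun h : ℝ => -∫ x, m x * (g x * D h x)) (𝓝[≠] 0)
      (𝓝 (-∫ x, m x * (g x * fderiv ℝ ψ x v))) := by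
    refine Tendsto.neg (tendsto_integral_filter_of_dominated_convergence
      (fun x => |m x * g x| * (C * ‖v‖)) ?_ ?_ ?_ ?_)
    · refine Eventually.of_forall fun h => ?_
      exact hm.aestronglyMeasurable.mul (hg.continuous.mul (hD h).continuous).aestronglyMeasurable
    · filter_upwards [hsmall] with h hh
      refine Eventually.of_forall fun x => ?_
      rw [Real.norm_eq_abs, ← mul_assoc, abs_mul]
      by_cases hx : x ∈ Metric.closedBall (0 : E) R
      · exact mul_le_mul_of_nonneg_left (hDb h hh.1 hh.2 x hx) (abs_nonneg _)
      · simp [hgR x hx]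
    · have := hm.integrable_smul_right_of_hasCompactSupport hg.continuous hc
      exact Integrable.mul_const (Integrable.abs (by simpa [smul_eq_mul, mul_comm] using this)) _
    · refine Eventually.of_forall fun x => ?_
      exact ((tendsto_symmetric_quotient hψ x v).const_mul _).const_mul _
  exact tendsto_nhds_unique t1 (by simpa only [key] using t2)

end Poisson

/-! ### Decay at infinity -/

section Decay
set_option linter.unusedSectionVars false
variable {E : Type*} [NormedAddCommGroup E] [InnerProductSpace ℝ E] [FiniteDimensional ℝ E]

/-- The smooth bump function that is `1` on the unit ball and vanishes outside the ball of
radius `2`. -/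
def unitBump (E : Type*) [NormedAddCommGroup E] : ContDiffBump (0 : E) :=
  ⟨1, 2, by norm_num, by norm_num⟩

/-- The cutoff function at scale `R > 0`: it is `1` where `‖x‖ ≤ R` and `0` where `‖x‖ ≥ 2 R`. -/
def cutoff (R : ℝ) (x : E) : ℝ := unitBump E (R⁻¹ • x)

theorem contDiff_cutoff (R : ℝ) : ContDiff ℝ 1 (cutoff R : E → ℝ) :=
  (unitBump E).contDiff.comp (contDiff_const_smul _)

theorem hasCompactSupport_cutoff {R : ℝ} (hR : R ≠ 0) :
    HasCompactSupport (cutoff R : E → ℝ) :=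
  (unitBump E).hasCompactSupport.comp_smul (inv_ne_zero hR)

theorem cutoff_nonneg (R : ℝ) (x : E) : 0 ≤ cutoff R x := (unitBump E).nonneg

theorem cutoff_eq_one {R : ℝ} (hR : 0 < R) {x : E} (hx : ‖x‖ ≤ R) : cutoff R x = 1 := by
  refine (unitBump E).one_of_mem_closedBall ?_
  rw [mem_closedBall_zero_iff, norm_smul, norm_inv, Real.norm_of_nonneg hR.le]
  show R⁻¹ * ‖x‖ ≤ 1
  rw [inv_mul_le_iff₀ hR]; linarith

theorem fderiv_comp_inv_smul (b : E → ℝ) (R : ℝ) (x : E) :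
    fderiv ℝ (fun y => b (R⁻¹ • y)) x = R⁻¹ • fderiv ℝ b (R⁻¹ • x) := fderiv_comp_smul _

theorem exists_bound_of_tendsto_cocompact {f : E → ℝ} (hf : Continuous f) {l : ℝ}
    (h : Tendsto f (cocompact E) (𝓝 l)) : ∃ C, 0 < C ∧ ∀ x, |f x| ≤ C := by
  have h1 : ∀ᶠ x in cocompact E, |f x| < |l| + 1 :=
    h.abs.eventually (gt_mem_nhds (by linarith))
  obtain ⟨K, hK, hKs⟩ := mem_cocompact.1 h1
  obtain ⟨C, C0, hC⟩ := exists_pos_bound_on_compact hK hf.continuousOn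
  refine ⟨max C (|l| + 1), by positivity, fun x => ?_⟩
  by_cases hx : x ∈ K
  · exact (hC x hx).trans (le_max_left _ _)
  · exact (le_of_lt (hKs hx)).trans (le_max_right _ _)

theorem tendsto_smul_cocompact {y : E} (hy : y ≠ 0) :
    Tendsto (fun R : ℝ => R • y) atTop (cocompact E) := by
  rw [← Metric.cobounded_eq_cocompact, ← tendsto_norm_atTop_iff_cobounded]
  simp only [norm_smul]
  exact (tendsto_norm_atTop_atTop).atTop_mul_const (norm_pos_iff.2 hy)

variable [MeasurableSpace E] [BorelSpace E]

/-- Caccioppoli's inequality for `ψ - 1` on a region where `m` vanishes. -/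
theorem IsWeakPoisson.caccioppoli {ψ m : E → ℝ} (hw : IsWeakPoisson ψ m)
    (hψ : ContDiff ℝ 1 ψ) {ζ : E → ℝ} (hζ : ContDiff ℝ 1 ζ) (hc : HasCompactSupport ζ)
    (hm : ∀ x, m x * ζ x = 0) :
    ∫ x, ‖gradient ψ x‖ ^ 2 * ζ x ^ 2 ≤ 4 * ∫ x, (ψ x - 1) ^ 2 * ‖fderiv ℝ ζ x‖ ^ 2 := by
  have hu : ContDiff ℝ 1 fun x => ψ x - 1 := hψ.sub contDiff_const
  have hz2 : ContDiff ℝ 1 fun x => ζ x * ζ x := hζ.mul hζ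
  have h := hw (fun x => (ψ x - 1) * (ζ x * ζ x)) (hu.mul hz2) hc.mul_left.mul_left
  have h0 : ∫ x, m x * ((ψ x - 1) * (ζ x * ζ x)) = 0 := by
    have : ∀ x, m x * ((ψ x - 1) * (ζ x * ζ x)) = 0 := fun x => by
      linear_combination (ψ x - 1) * ζ x * hm x
    simp [this]
  rw [h0, neg_zero] at h
  have e : ∀ x, fderiv ℝ (fun x => (ψ x - 1) * (ζ x * ζ x)) x (gradient ψ x)
      = ‖gradient ψ x‖ ^ 2 * ζ x ^ 2
        + 2 * (ψ x - 1) * ζ x * fderiv ℝ ζ x (gradient ψ x) := by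
    intro x
    have dζ := hζ.differentiable (by simp) x
    rw [fderiv_fun_mul (hu.differentiable (by simp) x) (hz2.differentiable (by simp) x),
      fderiv_fun_mul dζ dζ, fderiv_sub_const]
    simp only [add_apply, smul_apply, smul_eq_mul, fderiv_gradient_self]
    ring
  simp only [e] at h
  have hG := (continuous_gradient hψ).norm
  have hDn := (hζ.continuous_fderiv (n := 1) (by simp)).norm
  have hζc := hζ.continuous
  have hψc := hψ.continuous
  have i1 : Integrable fun x => ‖gradient ψ x‖ ^ 2 * ζ x ^ 2 :=
    Continuous.integrable_of_hasCompactSupport (by fun_prop)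
      (hc.mono fun x hx hx' => hx (by simp [hx']))
  have i2 : Integrable fun x => (ψ x - 1) ^ 2 * ‖fderiv ℝ ζ x‖ ^ 2 :=
    Continuous.integrable_of_hasCompactSupport (by fun_prop)
      ((hc.fderiv (𝕜 := ℝ)).mono fun x hx hx' => hx (by simp [hx']))
  have hDg := continuous_fderiv_gradient hζ hψ
  have i3 : Integrable fun x => ‖gradient ψ x‖ ^ 2 * ζ x ^ 2
        + 2 * (ψ x - 1) * ζ x * fderiv ℝ ζ x (gradient ψ x) :=
    Continuous.integrable_of_hasCompactSupport (by fun_prop)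
      (hc.mono fun x hx hx' => hx (by simp [hx']))
  have hle : ∫ x, (1 / 2 * (‖gradient ψ x‖ ^ 2 * ζ x ^ 2)
      - 2 * ((ψ x - 1) ^ 2 * ‖fderiv ℝ ζ x‖ ^ 2))
      ≤ ∫ x, (‖gradient ψ x‖ ^ 2 * ζ x ^ 2
        + 2 * (ψ x - 1) * ζ x * fderiv ℝ ζ x (gradient ψ x)) := by
    refine integral_mono ((i1.const_mul _).sub (i2.const_mul _)) i3 fun x => ?_
    have h1 : |fderiv ℝ ζ x (gradient ψ x)| ≤ ‖fderiv ℝ ζ x‖ * ‖gradient ψ x‖ :=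
      (fderiv ℝ ζ x).le_opNorm _
    have h2 : |(ψ x - 1) * ζ x * fderiv ℝ ζ x (gradient ψ x)|
        ≤ |ψ x - 1| * |ζ x| * (‖fderiv ℝ ζ x‖ * ‖gradient ψ x‖) := by
      rw [abs_mul, abs_mul]; gcongr
    have h3 := neg_abs_le ((ψ x - 1) * ζ x * fderiv ℝ ζ x (gradient ψ x))
    -- Young's inequality absorbs half of `|∇ψ|² ζ²`
    have h4 := sq_nonneg (‖gradient ψ x‖ * |ζ x| - 2 * |ψ x - 1| * ‖fderiv ℝ ζ x‖)
    have h5 := sq_abs (ζ x)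
    have h6 := sq_abs (ψ x - 1)
    simp only
    rw [← h5, ← h6]
    nlinarith
  rw [h, integral_sub (i1.const_mul _) (i2.const_mul _), integral_const_mul,
    integral_const_mul] at hle
  linarith

/-- In dimension three, the energy flux of `ψ` through the sphere at infinity vanishes as soon as
`ψ → 1`: Caccioppoli's inequality on the annulus `R/4 ≤ ‖x‖ ≤ 3 R` bounds it by a mean value
of `(ψ - 1)²` over that annulus. -/
theorem IsWeakPoisson.tendsto_flux_at_infinity (hdim : Module.finrank ℝ E = 3) {ψ m : E → ℝ}
    (hw : IsWeakPoisson ψ m) (hψ : ContDiff ℝ 1 ψ) (hlim : Tendsto ψ (cocompact E) (𝓝 1))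
    {R₀ : ℝ} (hm : ∀ x, R₀ ≤ ‖x‖ → m x = 0) :
    Tendsto (fun R : ℝ => ∫ x, ‖gradient ψ x‖ ^ 2 * ‖fderiv ℝ (cutoff R : E → ℝ) x‖) atTop
      (𝓝 0) := by
  let b₁ : ContDiffBump (0 : E) := ⟨1 / 4, 1 / 2, by norm_num, by norm_num⟩
  let b₂ : ContDiffBump (0 : E) := ⟨2, 3, by norm_num, by norm_num⟩
  -- `Z` is `1` where the gradient of `unitBump` lives, and `0` near the origin
  let Z : E → ℝ := fun y => b₂ y - b₁ y
  have hZ : ContDiff ℝ 1 Z := b₂.contDiff.sub b₁.contDiff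
  have hZc : HasCompactSupport Z := b₂.hasCompactSupport.sub b₁.hasCompactSupport
  have hZ0 : ∀ y : E, ‖y‖ ≤ 1 / 4 → Z y = 0 := fun y hy => by
    have h1 : b₁ y = 1 := b₁.one_of_mem_closedBall (mem_closedBall_zero_iff.2 hy)
    have h2 : b₂ y = 1 := b₂.one_of_mem_closedBall (by
      rw [mem_closedBall_zero_iff]; show ‖y‖ ≤ 2; linarith)
    simp [Z, h1, h2]
  have hZ1 : ∀ y : E, 1 ≤ ‖y‖ → ‖y‖ ≤ 2 → Z y = 1 := fun y hy hy' => by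
    have h1 : b₁ y = 0 := b₁.zero_of_le_dist (by
      rw [dist_zero_right]; show 1 / 2 ≤ ‖y‖; linarith)
    have h2 : b₂ y = 1 := b₂.one_of_mem_closedBall (by simpa using hy')
    simp [Z, h1, h2]
  have hbD : Continuous fun y => ‖fderiv ℝ (unitBump E) y‖ :=
    (((unitBump E).contDiff (n := 1)).continuous_fderiv (by simp)).norm
  obtain ⟨C, C0, hC⟩ := exists_pos_bound_on_compact (isCompact_closedBall (0 : E) 2)
    hbD.continuousOn
  have hdom : ∀ y : E, ‖fderiv ℝ (unitBump E) y‖ ≤ C * Z y ^ 2 := by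
    intro y
    rcases lt_or_ge ‖y‖ 1 with h | h
    · have : (unitBump E : E → ℝ) =ᶠ[𝓝 y] fun _ => 1 :=
        (unitBump E).eventuallyEq_one_of_mem_ball (mem_ball_zero_iff.2 h)
      rw [this.fderiv_eq]
      simp; positivity
    · rcases le_or_gt ‖y‖ 2 with h2 | h2
      · rw [hZ1 y h h2]
        simpa using hC y (by simpa using h2)
      · have : fderiv ℝ (unitBump E) y = 0 := fderiv_eq_zero_of_notMem_tsupport (by
          rw [(unitBump E).tsupport_eq, mem_closedBall_zero_iff]
          exact not_le.2 h2)
        rw [this]; simp; positivity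
  obtain ⟨B, B0, hB⟩ := exists_bound_of_tendsto_cocompact hψ.continuous hlim
  have hDZ : Continuous fun y => ‖fderiv ℝ Z y‖ ^ 2 :=
    (hZ.continuous_fderiv (by simp)).norm.pow 2
  have hDZi : Integrable fun y => ‖fderiv ℝ Z y‖ ^ 2 :=
    hDZ.integrable_of_hasCompactSupport
      ((hZc.fderiv (𝕜 := ℝ)).mono fun x hx hx' => hx (by simp [hx']))
  have hDZ0 : fderiv ℝ Z 0 = 0 := by
    have : Z =ᶠ[𝓝 0] fun _ => 0 := by
      filter_upwards [Metric.closedBall_mem_nhds (0 : E) (ε := 1 / 4) (by norm_num)] with y hy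
      exact hZ0 y (by simpa using hy)
    rw [this.fderiv_eq]; simp
  have hmean : Tendsto (fun R : ℝ => ∫ y, (ψ (R • y) - 1) ^ 2 * ‖fderiv ℝ Z y‖ ^ 2) atTop
      (𝓝 0) := by
    rw [show (0 : ℝ) = ∫ _ : E, (0 : ℝ) by simp]
    refine tendsto_integral_filter_of_dominated_convergence
      (fun y => (B + 1) ^ 2 * ‖fderiv ℝ Z y‖ ^ 2) ?_ ?_ (hDZi.const_mul _) ?_
    · refine Eventually.of_forall fun R => Continuous.aestronglyMeasurable ?_
      exact (((hψ.continuous.comp (continuous_const_smul R)).sub continuous_const).pow 2).mul hDZ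
    · refine Eventually.of_forall fun R => Eventually.of_forall fun y => ?_
      rw [Real.norm_of_nonneg (by positivity)]
      have h1 := abs_le.1 (hB (R • y))
      have h2 : (ψ (R • y) - 1) ^ 2 ≤ (B + 1) ^ 2 := by
        apply sq_le_sq'
        · linarith
        · linarith
      gcongr
    · refine Eventually.of_forall fun y => ?_
      by_cases hy : y = 0
      · simp [hy, hDZ0]
      · have := ((hlim.comp (tendsto_smul_cocompact hy)).sub_const 1).pow 2
        simpa using this.mul_const (‖fderiv ℝ Z y‖ ^ 2)
  have hfin : Tendsto (fun R : ℝ => 4 * C * ∫ y, (ψ (R • y) - 1) ^ 2 * ‖fderiv ℝ Z y‖ ^ 2)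
      atTop (𝓝 0) := by simpa using hmean.const_mul (4 * C)
  refine squeeze_zero' (Eventually.of_forall fun R => integral_nonneg fun x => by positivity) ?_
    hfin
  filter_upwards [eventually_gt_atTop 0, eventually_ge_atTop (4 * R₀)] with R hR hR0
  let ZR : E → ℝ := fun x => Z (R⁻¹ • x)
  have hZR : ContDiff ℝ 1 ZR := hZ.comp (contDiff_const_smul _)
  have hZRc : HasCompactSupport ZR := hZc.comp_smul (inv_ne_zero hR.ne')
  have hmZ : ∀ x, m x * ZR x = 0 := by
    intro x
    rcases le_or_gt R₀ ‖x‖ with h | h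
    · rw [hm x h, zero_mul]
    · have : ZR x = 0 := hZ0 _ (by
        rw [norm_smul, norm_inv, Real.norm_of_nonneg hR.le, inv_mul_le_iff₀ hR]; linarith)
      rw [this, mul_zero]
  have hcac := hw.caccioppoli hψ hZR hZRc hmZ
  have hG := (continuous_gradient hψ).norm
  have hZRcont := hZR.continuous
  have hcutD := ((contDiff_cutoff (E := E) R).continuous_fderiv (by simp)).norm
  have i1 : Integrable fun x => ‖gradient ψ x‖ ^ 2 * ‖fderiv ℝ (cutoff R : E → ℝ) x‖ :=
    Continuous.integrable_of_hasCompactSupport (by fun_prop)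
      (((hasCompactSupport_cutoff hR.ne').fderiv (𝕜 := ℝ)).mono
        fun x hx hx' => hx (by simp [hx']))
  have i2 : Integrable fun x => ‖gradient ψ x‖ ^ 2 * ZR x ^ 2 :=
    Continuous.integrable_of_hasCompactSupport (by fun_prop)
      (hZRc.mono fun x hx hx' => hx (by simp [hx']))
  have s1 : ∫ x, ‖gradient ψ x‖ ^ 2 * ‖fderiv ℝ (cutoff R : E → ℝ) x‖
      ≤ ∫ x, R⁻¹ * C * (‖gradient ψ x‖ ^ 2 * ZR x ^ 2) := by
    refine integral_mono i1 (i2.const_mul _) fun x => ?_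
    have : fderiv ℝ (cutoff R : E → ℝ) x = R⁻¹ • fderiv ℝ (unitBump E) (R⁻¹ • x) :=
      fderiv_comp_inv_smul _ R x
    simp only [this, norm_smul, norm_inv, Real.norm_of_nonneg hR.le]
    have h1 := mul_le_mul_of_nonneg_left (hdom (R⁻¹ • x)) (inv_nonneg.2 hR.le)
    calc _ ≤ ‖gradient ψ x‖ ^ 2 * (R⁻¹ * (C * Z (R⁻¹ • x) ^ 2)) := by gcongr
      _ = _ := by simp only [ZR]; ring
  -- the scaling of the integral by `R ^ 3` and of the squared gradient by `R⁻²` leaves one `R`,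
  -- which the factor `R⁻¹` of `s1` cancels
  have s2 : ∫ x, (ψ x - 1) ^ 2 * ‖fderiv ℝ ZR x‖ ^ 2
      = R * ∫ y, (ψ (R • y) - 1) ^ 2 * ‖fderiv ℝ Z y‖ ^ 2 := by
    have h1 := Measure.integral_comp_inv_smul_of_nonneg (volume : Measure E)
      (fun y => (ψ (R • y) - 1) ^ 2 * ‖fderiv ℝ Z y‖ ^ 2) hR.le
    rw [hdim] at h1
    have h2 : ∀ x, (ψ x - 1) ^ 2 * ‖fderiv ℝ ZR x‖ ^ 2
        = (R ^ 2)⁻¹ * ((ψ (R • R⁻¹ • x) - 1) ^ 2 * ‖fderiv ℝ Z (R⁻¹ • x)‖ ^ 2) := by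
      intro x
      have : fderiv ℝ ZR x = R⁻¹ • fderiv ℝ Z (R⁻¹ • x) := fderiv_comp_inv_smul _ R x
      rw [this, norm_smul, norm_inv, Real.norm_of_nonneg hR.le, smul_inv_smul₀ hR.ne']
      ring
    simp only [h2]
    rw [integral_const_mul, h1, smul_eq_mul]
    field_simp
  rw [integral_const_mul] at s1
  rw [s2] at hcac
  calc _ ≤ _ := s1
    _ ≤ R⁻¹ * C * (4 * (R * ∫ y, (ψ (R • y) - 1) ^ 2 * ‖fderiv ℝ Z y‖ ^ 2)) := by gcongr
    _ = _ := by field_simp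

end Decay

/-! ### Half-spaces and the flux through a plane -/

section HalfSpace
set_option linter.unusedSectionVars false
variable {E : Type*} [NormedAddCommGroup E] [InnerProductSpace ℝ E] [FiniteDimensional ℝ E]

/-- The signed distance of `x` from the plane through `a` with unit normal `n`. -/
def height (a n x : E) : ℝ := inner ℝ n (x - a)

/-- A smooth monotone approximation of the indicator function of the half-space
`0 < height a n x`; it vanishes off the half-space and is `1` at height at least `δ`. -/
def step (a n : E) (δ : ℝ) (x : E) : ℝ := Real.smoothTransition (height a n x / δ)

/-- The normal derivative of `step a n δ`, an approximation of the surface measure of the plane. -/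
def layer (a n : E) (δ : ℝ) (x : E) : ℝ := deriv Real.smoothTransition (height a n x / δ) / δ

variable {a n : E}

theorem contDiff_height {k : WithTop ℕ∞} : ContDiff ℝ k (height a n) :=
  (innerSL ℝ n).contDiff.comp (contDiff_id.sub contDiff_const)

theorem fderiv_height (x v : E) : fderiv ℝ (height a n) x v = inner ℝ n v := by
  have h : HasFDerivAt (height a n) (innerSL ℝ n) x :=
    (innerSL ℝ n).hasFDerivAt.comp x ((hasFDerivAt_id x).sub_const a)
  rw [h.fderiv]; rfl

theorem contDiff_step (δ : ℝ) : ContDiff ℝ 1 (step a n δ) :=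
  (Real.smoothTransition.contDiff (n := 1)).comp (contDiff_height.div_const δ)

theorem continuous_layer (δ : ℝ) : Continuous (layer a n δ) := by
  have h : Continuous (deriv Real.smoothTransition) :=
    (Real.smoothTransition.contDiff (n := 1)).continuous_deriv le_rfl
  exact (h.comp ((contDiff_height (k := 0)).continuous.div_const δ)).div_const δ

theorem fderiv_step (δ : ℝ) (x v : E) :
    fderiv ℝ (step a n δ) x v = layer a n δ x * inner ℝ n v := by
  have h1 : HasDerivAt Real.smoothTransition (deriv Real.smoothTransition (height a n x / δ))
      (height a n x / δ) :=
    ((Real.smoothTransition.contDiff (n := 1)).differentiable (by simp) _).hasDerivAt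
  have h2 : HasFDerivAt (fun y => height a n y / δ) (δ⁻¹ • fderiv ℝ (height a n) x) x := by
    simpa only [div_eq_mul_inv] using
      ((contDiff_height (k := 1)).differentiable (by simp) x).hasFDerivAt.mul_const δ⁻¹
  have h3 : HasFDerivAt (step a n δ) _ x := h1.comp_hasFDerivAt x h2
  rw [h3.fderiv]
  simp only [smul_apply, smul_eq_mul, fderiv_height, layer]
  ring

theorem step_nonneg (δ : ℝ) (x : E) : 0 ≤ step a n δ x := Real.smoothTransition.nonneg _

theorem step_le_one (δ : ℝ) (x : E) : step a n δ x ≤ 1 := Real.smoothTransition.le_one _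

theorem step_eq_zero {δ : ℝ} (hδ : 0 < δ) {x : E} (hx : height a n x ≤ 0) : step a n δ x = 0 :=
  Real.smoothTransition.zero_of_nonpos (div_nonpos_of_nonpos_of_nonneg hx hδ.le)

theorem step_eq_one {δ : ℝ} (hδ : 0 < δ) {x : E} (hx : δ ≤ height a n x) : step a n δ x = 1 :=
  Real.smoothTransition.one_of_one_le ((one_le_div hδ).2 hx)

theorem layer_nonneg {δ : ℝ} (hδ : 0 < δ) (x : E) : 0 ≤ layer a n δ x :=
  div_nonneg (Real.smoothTransition.monotone.deriv_nonneg) hδ.le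

theorem layer_eq_zero {δ : ℝ} (hδ : 0 < δ) {x : E} (hx : δ < |height a n x|) :
    layer a n δ x = 0 := by
  have h : deriv Real.smoothTransition (height a n x / δ) = 0 := by
    rcases lt_abs.1 hx with h | h
    · have : Real.smoothTransition =ᶠ[𝓝 (height a n x / δ)] fun _ => 1 := by
        filter_upwards [lt_mem_nhds ((one_lt_div hδ).2 h)] with t ht
        exact Real.smoothTransition.one_of_one_le ht.le
      rw [this.deriv_eq]; simp
    · have : Real.smoothTransition =ᶠ[𝓝 (height a n x / δ)] fun _ => 0 := by
        have h0 : height a n x / δ < 0 := div_neg_of_neg_of_pos (by linarith) hδ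
        filter_upwards [gt_mem_nhds h0] with t ht
        exact Real.smoothTransition.zero_of_nonpos ht.le
      rw [this.deriv_eq]; simp
  rw [layer, h, zero_div]

variable [MeasurableSpace E] [BorelSpace E]

theorem integral_layer_mul (hn : ‖n‖ = 1) (δ : ℝ) {b : E → ℝ} (hb : ContDiff ℝ 1 b)
    (hc : HasCompactSupport b) :
    ∫ x, layer a n δ x * b x = -∫ x, step a n δ x * fderiv ℝ b x n := by
  rw [integral_mul_fderiv_eq_neg (contDiff_step δ) hb hc n, neg_neg]
  refine integral_congr_ae (Eventually.of_forall fun x => ?_)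
  simp only [fderiv_step, real_inner_self_eq_norm_sq, hn]
  ring

/-- The layer functions converge to a measure carried by the plane: their integrals against a
continuous function that vanishes on the plane tend to zero. Their total mass on a compact set is
bounded because integration by parts turns them into `step`. -/
theorem tendsto_integral_layer_mul (hn : ‖n‖ = 1) {f : E → ℝ} (hf : Continuous f)
    (hc : HasCompactSupport f) (h0 : ∀ x, height a n x = 0 → f x = 0) :
    Tendsto (fun δ => ∫ x, layer a n δ x * f x) (𝓝[>] 0) (𝓝 0) := by
  obtain ⟨R, R0, hR⟩ := hc.isCompact.isBounded.subset_closedBall_lt 0 0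
  let b : E → ℝ := cutoff R
  have hb : ContDiff ℝ 1 b := contDiff_cutoff R
  have hbc : HasCompactSupport b := hasCompactSupport_cutoff R0.ne'
  set I := ∫ x, |fderiv ℝ b x n| with hI
  have hI0 : 0 ≤ I := integral_nonneg fun x => abs_nonneg _
  have hIi : Integrable fun x => |fderiv ℝ b x n| :=
    ((continuous_fderiv_const hb n).integrable_of_hasCompactSupport
      (hbc.fderiv_apply (𝕜 := ℝ) n)).abs
  have hmass : ∀ δ, ∫ x, layer a n δ x * b x ≤ I := by
    intro δ
    rw [integral_layer_mul hn δ hb hbc, ← integral_neg]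
    refine integral_mono ?_ hIi fun x => ?_
    · exact (((contDiff_step δ).continuous.mul
        (continuous_fderiv_const hb n)).integrable_of_hasCompactSupport
        (hbc.fderiv_apply (𝕜 := ℝ) n).mul_left).neg
    · refine (neg_le_abs _).trans ?_
      rw [abs_mul, abs_of_nonneg (step_nonneg δ x)]
      exact mul_le_of_le_one_left (abs_nonneg _) (step_le_one δ x)
  have hU : UniformContinuous f := hc.uniformContinuous_of_continuous hf
  rw [Metric.tendsto_nhds]
  intro ε hε
  obtain ⟨r, r0, hr⟩ := Metric.uniformContinuous_iff.1 hU (ε / (I + 1)) (by positivity)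
  filter_upwards [self_mem_nhdsWithin, mem_nhdsWithin_of_mem_nhds (gt_mem_nhds r0)] with δ hδ hδr
  have hδ : 0 < δ := hδ
  have hi : Integrable fun x => layer a n δ x * f x :=
    ((continuous_layer δ).mul hf).integrable_of_hasCompactSupport hc.mul_left
  have hib : Integrable fun x => layer a n δ x * b x :=
    ((continuous_layer δ).mul hb.continuous).integrable_of_hasCompactSupport hbc.mul_left
  rw [dist_zero_right]
  calc ‖∫ x, layer a n δ x * f x‖ ≤ ∫ x, ‖layer a n δ x * f x‖ := norm_integral_le_integral_norm _
    _ ≤ ∫ x, ε / (I + 1) * (layer a n δ x * b x) := by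
        refine integral_mono hi.norm (hib.const_mul _) fun x => ?_
        simp only [Real.norm_eq_abs, abs_mul, abs_of_nonneg (layer_nonneg hδ x)]
        by_cases hx : x ∈ tsupport f
        · have hbx : b x = 1 := cutoff_eq_one R0 (by simpa using hR hx)
          rcases lt_or_ge δ |height a n x| with h | h
          · simp [layer_eq_zero hδ h]
          · -- `f` is compared with its value at the orthogonal projection of `x` to the plane
            have hp : height a n (x - height a n x • n) = 0 := by
              simp only [height]
              rw [sub_right_comm, inner_sub_right _ (x - a), inner_smul_right,
                real_inner_self_eq_norm_sq, hn]
              ring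
            have hd : dist x (x - height a n x • n) < r := by
              rw [dist_eq_norm, sub_sub_cancel, norm_smul, hn, mul_one, Real.norm_eq_abs]
              exact h.trans_lt hδr
            have := hr hd
            rw [h0 _ hp, Real.dist_eq, sub_zero] at this
            rw [hbx, mul_one, mul_comm]
            exact mul_le_mul_of_nonneg_right this.le (layer_nonneg hδ x)
        · rw [image_eq_zero_of_notMem_tsupport hx, abs_zero, mul_zero]
          have := layer_nonneg (a := a) (n := n) hδ x
          have : 0 ≤ b x := cutoff_nonneg R x
          positivity
    _ ≤ ε / (I + 1) * I := by
        rw [integral_const_mul]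
        exact mul_le_mul_of_nonneg_left (hmass δ) (by positivity)
    _ < ε := by
        rw [div_mul_eq_mul_div, div_lt_iff₀ (by positivity)]
        nlinarith

theorem tendsto_step (x : E) :
    Tendsto (fun δ => step a n δ x) (𝓝[>] 0)
      (𝓝 ({x | 0 < height a n x}.indicator (fun _ => (1 : ℝ)) x)) := by
  by_cases hx : 0 < height a n x
  · rw [indicator_of_mem (by exact hx)]
    refine tendsto_const_nhds.congr' ?_
    filter_upwards [self_mem_nhdsWithin, mem_nhdsWithin_of_mem_nhds (gt_mem_nhds hx)] with δ h h'
    exact (step_eq_one h h'.le).symm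
  · rw [indicator_of_notMem (by exact hx)]
    refine tendsto_const_nhds.congr' ?_
    filter_upwards [self_mem_nhdsWithin] with δ h
    exact (step_eq_zero h (not_lt.1 hx)).symm

theorem measurableSet_halfSpace : MeasurableSet {x : E | 0 < height a n x} :=
  (isOpen_lt continuous_const (contDiff_height (k := 0)).continuous).measurableSet

theorem tendsto_integral_step_mul {F : E → ℝ} (hF : Integrable F) :
    Tendsto (fun δ => ∫ x, step a n δ x * F x) (𝓝[>] 0)
      (𝓝 (∫ x in {x | 0 < height a n x}, F x)) := by
  rw [← integral_indicator measurableSet_halfSpace]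
  refine tendsto_integral_filter_of_dominated_convergence (fun x => |F x|) ?_ ?_ hF.abs ?_
  · exact Eventually.of_forall fun δ =>
      (contDiff_step δ).continuous.aestronglyMeasurable.mul hF.aestronglyMeasurable
  · refine Eventually.of_forall fun δ => Eventually.of_forall fun x => ?_
    rw [Real.norm_eq_abs, abs_mul, abs_of_nonneg (step_nonneg δ x)]
    exact mul_le_of_le_one_left (abs_nonneg _) (step_le_one δ x)
  · refine Eventually.of_forall fun x => ?_
    convert (tendsto_step x).mul_const (F x) using 2
    by_cases hx : x ∈ {x : E | 0 < height a n x}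
    · simp only [indicator_of_mem hx, one_mul]
    · simp only [indicator_of_notMem hx, zero_mul]

/-! ### A radial bump function with an explicit derivative -/

/-- The radial bump function `exp (-1 / (r² - ‖x - p‖²))` supported in the ball of radius `r`
around `p`. Unlike for a general bump function, the sign of its radial derivative is known. -/
def radialBump (p : E) (r : ℝ) (x : E) : ℝ := expNegInvGlue (r ^ 2 - ‖x - p‖ ^ 2)

/-- The density such that `∇ (radialBump p r) = - radialDensity p r x • (x - p)`. -/
def radialDensity (p : E) (r : ℝ) (x : E) : ℝ := 2 * deriv expNegInvGlue (r ^ 2 - ‖x - p‖ ^ 2)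

theorem contDiff_radialBump (p : E) (r : ℝ) : ContDiff ℝ 1 (radialBump p r) :=
  (expNegInvGlue.contDiff (n := 1)).comp
    (contDiff_const.sub ((contDiff_id.sub contDiff_const).norm_sq ℝ))

theorem continuous_radialDensity (p : E) (r : ℝ) : Continuous (radialDensity p r) := by
  have h : Continuous (deriv expNegInvGlue) :=
    (expNegInvGlue.contDiff (n := 1)).continuous_deriv le_rfl
  exact continuous_const.mul (h.comp (by fun_prop))

theorem deriv_expNegInvGlue_pos {t : ℝ} (ht : 0 < t) : 0 < deriv expNegInvGlue t := by
  have h := expNegInvGlue.hasDerivAt_polynomial_eval_inv_mul 1 t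
  simp only [Polynomial.eval_one, one_mul] at h
  rw [h.deriv]
  have := expNegInvGlue.pos_of_pos ht
  simp
  positivity

theorem radialDensity_nonneg (p : E) (r : ℝ) (x : E) : 0 ≤ radialDensity p r x :=
  mul_nonneg zero_le_two expNegInvGlue.monotone.deriv_nonneg

theorem radialDensity_pos {p : E} {r : ℝ} {x : E} (hx : ‖x - p‖ < r) :
    0 < radialDensity p r x := by
  refine mul_pos two_pos (deriv_expNegInvGlue_pos ?_)
  nlinarith [norm_nonneg (x - p)]

theorem fderiv_radialBump (p : E) (r : ℝ) (x v : E) :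
    fderiv ℝ (radialBump p r) x v = -(radialDensity p r x * inner ℝ (x - p) v) := by
  have h1 : HasDerivAt expNegInvGlue (deriv expNegInvGlue (r ^ 2 - ‖x - p‖ ^ 2))
      (r ^ 2 - ‖x - p‖ ^ 2) :=
    ((expNegInvGlue.contDiff (n := 1)).differentiable (by simp) _).hasDerivAt
  have h2 := ((hasFDerivAt_id x).sub_const p).norm_sq.const_sub (r ^ 2)
  have h3 : HasFDerivAt (radialBump p r) _ x := h1.comp_hasFDerivAt x h2
  rw [h3.fderiv]
  simp [radialDensity, inner_sub_left]
  ring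

theorem radialBump_nonneg (p : E) (r : ℝ) (x : E) : 0 ≤ radialBump p r x :=
  expNegInvGlue.nonneg _

theorem radialBump_pos {p : E} {r : ℝ} {x : E} (hx : ‖x - p‖ < r) : 0 < radialBump p r x := by
  refine expNegInvGlue.pos_of_pos ?_
  nlinarith [norm_nonneg (x - p)]

theorem radialBump_le_one (p : E) (r : ℝ) (x : E) : radialBump p r x ≤ 1 := by
  simp only [radialBump, expNegInvGlue]
  split_ifs with h
  · exact zero_le_one
  · rw [Real.exp_le_one_iff, neg_nonpos, inv_nonneg]; linarith

theorem radialBump_eq_zero {p : E} {r : ℝ} (hr : 0 ≤ r) {x : E} (hx : r ≤ ‖x - p‖) :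
    radialBump p r x = 0 :=
  expNegInvGlue.zero_of_nonpos (by nlinarith)

theorem hasCompactSupport_radialBump (p : E) {r : ℝ} (hr : 0 ≤ r) :
    HasCompactSupport (radialBump p r) := by
  refine HasCompactSupport.intro (isCompact_closedBall p r) fun x hx => ?_
  refine radialBump_eq_zero hr ?_
  rw [Metric.mem_closedBall, dist_eq_norm] at hx
  linarith

theorem radialDensity_eq_zero {p : E} {r : ℝ} (hr : 0 ≤ r) {x : E} (hx : r < ‖x - p‖) :
    radialDensity p r x = 0 := by
  have : expNegInvGlue =ᶠ[𝓝 (r ^ 2 - ‖x - p‖ ^ 2)] fun _ => 0 := by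
    have h0 : r ^ 2 - ‖x - p‖ ^ 2 < 0 := by nlinarith
    filter_upwards [gt_mem_nhds h0] with t ht
    exact expNegInvGlue.zero_of_nonpos ht.le
  rw [radialDensity, this.deriv_eq]; simp

theorem hasCompactSupport_radialDensity (p : E) {r : ℝ} (hr : 0 ≤ r) :
    HasCompactSupport (radialDensity p r) := by
  refine HasCompactSupport.intro (isCompact_closedBall p r) fun x hx => ?_
  refine radialDensity_eq_zero hr ?_
  rw [Metric.mem_closedBall, dist_eq_norm] at hx
  linarith

/-! ### Vanishing of the gradient on a plane without flux -/

set_option maxHeartbeats 400000 in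
/-- If the normal derivative of `ψ` vanishes on a plane and the total force on the matter on one
side of it is zero, then the whole gradient of `ψ` vanishes on the plane: the stress identity,
localized to the half-space, says that the normal stress `-½ |∇ψ|²` integrates to zero over it. -/
theorem IsWeakPoisson.gradient_eq_zero_on_plane (hdim : Module.finrank ℝ E = 3) {ψ m : E → ℝ}
    (hw : IsWeakPoisson ψ m) (hψ : ContDiff ℝ 1 ψ) (hlim : Tendsto ψ (cocompact E) (𝓝 1))
    (hmi : LocallyIntegrable m) {R₀ : ℝ} (hm : ∀ x, R₀ ≤ ‖x‖ → m x = 0) (hn : ‖n‖ = 1)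
    (hnormal : ∀ x, height a n x = 0 → fderiv ℝ ψ x n = 0)
    (hforce : ∫ x in {x | 0 < height a n x}, m x * fderiv ℝ ψ x n = 0)
    {p : E} (hp : height a n p = 0) : gradient ψ p = 0 := by
  by_contra hne
  have hG := continuous_gradient hψ
  have hGn := hG.norm
  set μ := ‖gradient ψ p‖ ^ 2 / 2 with hμ
  have hgp : 0 < ‖gradient ψ p‖ := norm_pos_iff.2 hne
  have hμ0 : 0 < μ := by positivity
  have hev : ∀ᶠ x in 𝓝 p, μ < ‖gradient ψ x‖ ^ 2 :=
    (hGn.pow 2).continuousAt.eventually (lt_mem_nhds (by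
      show μ < ‖gradient ψ p‖ ^ 2
      linarith [pow_pos hgp 2]))
  obtain ⟨r, r0, hr⟩ := Metric.eventually_nhds_iff.1 hev
  let b := radialBump p r
  have hb : ContDiff ℝ 1 b := contDiff_radialBump p r
  have hbc : HasCompactSupport b := hasCompactSupport_radialBump p r0.le
  have hdens := continuous_radialDensity p r
  have hdensc := hasCompactSupport_radialDensity p r0.le
  have hh : Continuous (height a n) := (contDiff_height (k := 0)).continuous
  have hhp : ∀ x, inner ℝ (x - p) n = height a n x := fun x => by
    have : x - p = (x - a) - (p - a) := by abel
    rw [real_inner_comm, this, inner_sub_right]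
    change _ - height a n p = _
    rw [hp, sub_zero]; rfl
  -- a lower bound, uniform in `δ`, for the mass of `b` in the layer
  let k : ℝ → E → ℝ := fun δ x => step a n δ x * (radialDensity p r x * height a n x)
  have hkc : ∀ δ, Continuous (k δ) := fun δ =>
    (contDiff_step δ).continuous.mul (hdens.mul hh)
  have hks : ∀ δ, HasCompactSupport (k δ) := fun δ => hdensc.mul_right.mul_left
  have hk0 : ∀ δ, 0 < δ → ∀ x, 0 ≤ k δ x := by
    intro δ hδ x
    rcases le_or_gt (height a n x) 0 with h | h
    · simp [k, step_eq_zero hδ h]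
    · exact mul_nonneg (step_nonneg _ _) (mul_nonneg (radialDensity_nonneg _ _ _) h.le)
  have hκ : 0 < ∫ x, k 1 x := by
    refine (hkc 1).integral_pos_of_hasCompactSupport_nonneg_nonzero (hks 1) (hk0 1 one_pos)
      (x := p + (r / 2) • n) ?_
    have h1 : height a n (p + (r / 2) • n) = r / 2 := by
      rw [← hhp, add_sub_cancel_left, real_inner_comm, inner_smul_right,
        real_inner_self_eq_norm_sq, hn]
      ring
    have h2 : ‖p + (r / 2) • n - p‖ < r := by
      rw [add_sub_cancel_left, norm_smul, hn, Real.norm_of_nonneg (by positivity)]; linarith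
    have h3 : 0 < step a n 1 (p + (r / 2) • n) :=
      Real.smoothTransition.pos_of_pos (by rw [h1]; positivity)
    have h4 := radialDensity_pos h2
    simp only [k, h1]
    positivity
  have hlow : ∀ δ, 0 < δ → δ ≤ 1 → ∫ x, k 1 x ≤ ∫ x, layer a n δ x * b x := by
    intro δ hδ hδ1
    rw [integral_layer_mul hn δ hb hbc, ← integral_neg]
    have e : ∀ x, -(step a n δ x * fderiv ℝ b x n) = k δ x := by
      intro x
      simp only [b, fderiv_radialBump, hhp, k]; ring
    simp only [e]
    refine integral_mono ((hkc 1).integrable_of_hasCompactSupport (hks 1))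
      ((hkc δ).integrable_of_hasCompactSupport (hks δ)) fun x => ?_
    rcases le_or_gt (height a n x) 0 with h | h
    · simp [k, step_eq_zero one_pos h, step_eq_zero hδ h]
    · have h1 : step a n 1 x ≤ step a n δ x := by
        refine Real.smoothTransition.monotone ?_
        rw [div_one, le_div_iff₀ hδ]
        nlinarith
      exact mul_le_mul_of_nonneg_right h1 (mul_nonneg (radialDensity_nonneg _ _ _) h.le)
  -- the estimate at a fixed large scale `R`
  have main : ∀ R, 0 < R → R₀ ≤ R → ‖p‖ + r ≤ R →
      1 / 2 * μ * ∫ x, k 1 x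
        ≤ 3 / 2 * ∫ x, ‖gradient ψ x‖ ^ 2 * ‖fderiv ℝ (cutoff R : E → ℝ) x‖ := by
    intro R hR hRR hRp
    let ζ : E → ℝ := cutoff R
    have hζ : ContDiff ℝ 1 ζ := contDiff_cutoff R
    have hζc : HasCompactSupport ζ := hasCompactSupport_cutoff hR.ne'
    have hζcont := hζ.continuous
    have hψn := continuous_fderiv_const hψ n
    have hζD := (hζ.continuous_fderiv (n := 1) (by simp)).norm
    let P : E → ℝ := fun x => fderiv ℝ ζ x (gradient ψ x) * fderiv ℝ ψ x n
      - 1 / 2 * ‖gradient ψ x‖ ^ 2 * fderiv ℝ ζ x n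
    have hPc : Continuous P :=
      ((continuous_fderiv_gradient hζ hψ).mul hψn).sub
        ((continuous_const.mul (hGn.pow 2)).mul (continuous_fderiv_const hζ n))
    have hPs : HasCompactSupport P :=
      (hζc.fderiv (𝕜 := ℝ)).mono fun x hx hx' => hx (by simp [P, hx'])
    have hF : Integrable fun x => ‖gradient ψ x‖ ^ 2 * ‖fderiv ℝ ζ x‖ :=
      Continuous.integrable_of_hasCompactSupport (by fun_prop)
        ((hζc.fderiv (𝕜 := ℝ)).mono fun x hx hx' => hx (by simp [hx']))
    have hPb : ∀ x, |P x| ≤ 3 / 2 * (‖gradient ψ x‖ ^ 2 * ‖fderiv ℝ ζ x‖) := by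
      intro x
      have h1 : |fderiv ℝ ζ x (gradient ψ x)| ≤ ‖fderiv ℝ ζ x‖ * ‖gradient ψ x‖ :=
        (fderiv ℝ ζ x).le_opNorm _
      have h2 : |fderiv ℝ ψ x n| ≤ ‖gradient ψ x‖ := by
        have := (fderiv ℝ ψ x).le_opNorm n
        rwa [hn, mul_one, norm_fderiv_eq_norm_gradient] at this
      have h3 : |fderiv ℝ ζ x n| ≤ ‖fderiv ℝ ζ x‖ := by
        have := (fderiv ℝ ζ x).le_opNorm n
        rwa [hn, mul_one] at this
      refine (abs_sub _ _).trans ?_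
      rw [abs_mul, abs_mul, abs_of_nonneg (show 0 ≤ 1 / 2 * ‖gradient ψ x‖ ^ 2 by positivity)]
      have h4 := mul_le_mul h1 h2 (abs_nonneg _) (by positivity)
      have h5 := mul_le_mul_of_nonneg_left h3 (show 0 ≤ 1 / 2 * ‖gradient ψ x‖ ^ 2 by positivity)
      linarith
    have hid : ∀ δ, 1 / 2 * ∫ x, layer a n δ x * (ζ x * ‖gradient ψ x‖ ^ 2)
        = (∫ x, layer a n δ x * (ζ x * fderiv ℝ ψ x n ^ 2)) + (∫ x, step a n δ x * P x)
          + ∫ x, step a n δ x * (m x * (ζ x * fderiv ℝ ψ x n)) := by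
      intro δ
      have hs := contDiff_step (a := a) (n := n) δ
      have hst := hw.stress_identity hψ hmi (g := fun x => step a n δ x * ζ x) (hs.mul hζ)
        hζc.mul_left n
      have e : ∀ x, fderiv ℝ (fun x => step a n δ x * ζ x) x (gradient ψ x) * fderiv ℝ ψ x n
          - 1 / 2 * ‖gradient ψ x‖ ^ 2 * fderiv ℝ (fun x => step a n δ x * ζ x) x n
          = layer a n δ x * (ζ x * fderiv ℝ ψ x n ^ 2) + step a n δ x * P x
            - 1 / 2 * (layer a n δ x * (ζ x * ‖gradient ψ x‖ ^ 2)) := by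
        intro x
        rw [fderiv_fun_mul (hs.differentiable (by simp) x) (hζ.differentiable (by simp) x)]
        simp only [add_apply, smul_apply, smul_eq_mul, fderiv_step,
          real_inner_self_eq_norm_sq, hn, P]
        rw [show inner ℝ n (gradient ψ x) = fderiv ℝ ψ x n by
          rw [real_inner_comm, inner_gradient_left]]
        ring
      have e2 : ∀ x, m x * (step a n δ x * ζ x * fderiv ℝ ψ x n)
          = step a n δ x * (m x * (ζ x * fderiv ℝ ψ x n)) := fun x => by ring
      simp only [e, e2] at hst
      have hl := continuous_layer (a := a) (n := n) δ
      have i1 : Integrable fun x => layer a n δ x * (ζ x * fderiv ℝ ψ x n ^ 2) :=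
        Continuous.integrable_of_hasCompactSupport (by fun_prop) hζc.mul_right.mul_left
      have i2 : Integrable fun x => step a n δ x * P x :=
        (hs.continuous.mul hPc).integrable_of_hasCompactSupport hPs.mul_left
      have i3 : Integrable fun x => layer a n δ x * (ζ x * ‖gradient ψ x‖ ^ 2) :=
        Continuous.integrable_of_hasCompactSupport (by fun_prop) hζc.mul_right.mul_left
      have i12 : Integrable fun x => layer a n δ x * (ζ x * fderiv ℝ ψ x n ^ 2)
          + step a n δ x * P x := i1.add i2
      rw [integral_sub i12 (i3.const_mul _), integral_add i1 i2, integral_const_mul] at hst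
      linarith
    have hstep : ∀ δ, ∫ x, step a n δ x * P x
        ≤ 3 / 2 * ∫ x, ‖gradient ψ x‖ ^ 2 * ‖fderiv ℝ ζ x‖ := by
      intro δ
      rw [← integral_const_mul]
      refine integral_mono (((contDiff_step δ).continuous.mul
        hPc).integrable_of_hasCompactSupport hPs.mul_left) (hF.const_mul _) fun x => ?_
      refine (le_abs_self _).trans ?_
      rw [abs_mul, abs_of_nonneg (step_nonneg δ x)]
      exact (mul_le_of_le_one_left (abs_nonneg _) (step_le_one δ x)).trans (hPb x)
    have hlow2 : ∀ δ, 0 < δ → μ * ∫ x, layer a n δ x * b x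
        ≤ ∫ x, layer a n δ x * (ζ x * ‖gradient ψ x‖ ^ 2) := by
      intro δ hδ
      have hl := continuous_layer (a := a) (n := n) δ
      rw [← integral_const_mul]
      refine integral_mono (((hl.mul hb.continuous).integrable_of_hasCompactSupport
        hbc.mul_left).const_mul _) (Continuous.integrable_of_hasCompactSupport (by fun_prop)
          hζc.mul_right.mul_left) fun x => ?_
      have h1 : μ * b x ≤ ζ x * ‖gradient ψ x‖ ^ 2 := by
        rcases lt_or_ge ‖x - p‖ r with h | h
        · have h2 : ζ x = 1 := cutoff_eq_one hR (by
            have := norm_add_le (x - p) p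
            rw [sub_add_cancel] at this
            linarith)
          have h3 : μ < ‖gradient ψ x‖ ^ 2 := hr (by rwa [dist_eq_norm])
          have h4 : b x ≤ 1 := radialBump_le_one _ _ _
          rw [h2, one_mul]
          nlinarith
        · have h2 : b x = 0 := radialBump_eq_zero r0.le h
          rw [h2, mul_zero]
          exact mul_nonneg (cutoff_nonneg _ _) (by positivity)
      have := mul_le_mul_of_nonneg_left h1 (layer_nonneg (a := a) (n := n) hδ x)
      simp only
      linarith
    have hmint : Integrable fun x => m x * (ζ x * fderiv ℝ ψ x n) :=
      hmi.integrable_smul_right_of_hasCompactSupport (hζcont.mul hψn) hζc.mul_right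
    have hfc : Continuous fun x => ζ x * fderiv ℝ ψ x n ^ 2 := by fun_prop
    have hfs : HasCompactSupport fun x => ζ x * fderiv ℝ ψ x n ^ 2 :=
      hζc.mono fun x hx hx' => hx (by simp [hx'])
    have hlay : Tendsto (fun δ => ∫ x, layer a n δ x * (ζ x * fderiv ℝ ψ x n ^ 2)) (𝓝[>] 0)
        (𝓝 0) := tendsto_integral_layer_mul hn hfc hfs fun x hx => by simp [hnormal x hx]
    have hlimit := (hlay.add_const
        (3 / 2 * ∫ x, ‖gradient ψ x‖ ^ 2 * ‖fderiv ℝ ζ x‖)).add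
      (tendsto_integral_step_mul (a := a) (n := n) hmint)
    have hz : ∫ x in {x | 0 < height a n x}, m x * (ζ x * fderiv ℝ ψ x n) = 0 := by
      refine (integral_congr_ae (Eventually.of_forall fun x => ?_)).trans hforce
      rcases le_or_gt R₀ ‖x‖ with h | h
      · simp [hm x h]
      · have : ζ x = 1 := cutoff_eq_one hR (by linarith)
        simp [this]
    rw [hz, zero_add, add_zero] at hlimit
    refine ge_of_tendsto hlimit ?_
    filter_upwards [self_mem_nhdsWithin, mem_nhdsWithin_of_mem_nhds
      (gt_mem_nhds (zero_lt_one (α := ℝ)))] with δ hδ hδ1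
    have h1 := hid δ
    have h2 := hstep δ
    have h3 := hlow2 δ hδ
    have h4 := mul_le_mul_of_nonneg_left (hlow δ hδ hδ1.le) hμ0.le
    linarith
  have hflux := (hw.tendsto_flux_at_infinity hdim hψ hlim hm).const_mul (3 / 2)
  rw [mul_zero] at hflux
  have hle : 1 / 2 * μ * ∫ x, k 1 x ≤ 0 := by
    refine ge_of_tendsto hflux ?_
    filter_upwards [eventually_gt_atTop 0, eventually_ge_atTop R₀,
      eventually_ge_atTop (‖p‖ + r)] with R h1 h2 h3
    exact main R h1 h2 h3
  have : 0 < 1 / 2 * μ * ∫ x, k 1 x := mul_pos (mul_pos one_half_pos hμ0) hκ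
  linarith

end HalfSpace

/-! ### Superharmonic functions and uniqueness -/

section Superharmonic
set_option linter.unusedSectionVars false
variable {E : Type*} [NormedAddCommGroup E] [InnerProductSpace ℝ E] [FiniteDimensional ℝ E]
  [MeasurableSpace E] [BorelSpace E] {a n : E}

/-- The mean value of `w` around `p` at scale `R`, with a fixed radial weight. -/
def radialMean (w : E → ℝ) (p : E) (R : ℝ) : ℝ := ∫ y, w (p + R • y) * radialDensity 0 1 y

theorem hasDerivAt_radialMean {w : E → ℝ} (hw : ContDiff ℝ 1 w) (p : E) (R : ℝ) :
    HasDerivAt (radialMean w p) (∫ y, fderiv ℝ w (p + R • y) y * radialDensity 0 1 y) R := by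
  have hη := continuous_radialDensity (0 : E) 1
  have hηc := hasCompactSupport_radialDensity (0 : E) zero_le_one
  have hDw := hw.continuous_fderiv (n := 1) (by simp)
  obtain ⟨C, C0, hC⟩ := exists_pos_bound_on_compact (isCompact_closedBall p (|R| + 1))
    hDw.norm.continuousOn
  have hF : ∀ S : ℝ, Continuous fun y => w (p + S • y) * radialDensity 0 1 y := fun S =>
    (hw.continuous.comp (by fun_prop)).mul hη
  have hF' : Continuous fun y => fderiv ℝ w (p + R • y) y * radialDensity 0 1 y :=
    ((hDw.comp (by fun_prop : Continuous fun y : E => p + R • y)).clm_apply continuous_id).mul hη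
  refine (hasDerivAt_integral_of_dominated_loc_of_deriv_le (μ := (volume : Measure E))
    (F := fun S y => w (p + S • y) * radialDensity 0 1 y)
    (F' := fun S y => fderiv ℝ w (p + S • y) y * radialDensity 0 1 y)
    (bound := fun y => C * radialDensity 0 1 y) (Metric.ball_mem_nhds R one_pos)
    (Eventually.of_forall fun S => (hF S).aestronglyMeasurable)
    ((hF R).integrable_of_hasCompactSupport hηc.mul_left) hF'.aestronglyMeasurable
    (Eventually.of_forall fun y S hS => ?_)
    ((hη.integrable_of_hasCompactSupport hηc).const_mul C)
    (Eventually.of_forall fun y S hS => ?_)).2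
  · rw [norm_mul, Real.norm_of_nonneg (radialDensity_nonneg _ _ _)]
    rcases le_or_gt ‖y‖ 1 with h | h
    · refine mul_le_mul_of_nonneg_right ?_ (radialDensity_nonneg _ _ _)
      have hS' : |S| ≤ |R| + 1 := by
        rw [Metric.mem_ball, Real.dist_eq] at hS
        have := abs_sub_abs_le_abs_sub S R
        linarith
      have h1 : p + S • y ∈ Metric.closedBall p (|R| + 1) := by
        rw [Metric.mem_closedBall, dist_eq_norm, add_sub_cancel_left, norm_smul,
          Real.norm_eq_abs]
        nlinarith [abs_nonneg S, norm_nonneg y]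
      have h2 : ‖fderiv ℝ w (p + S • y)‖ ≤ C := by simpa using hC _ h1
      calc _ ≤ ‖fderiv ℝ w (p + S • y)‖ * ‖y‖ := (fderiv ℝ w (p + S • y)).le_opNorm y
        _ ≤ C * 1 := by gcongr
        _ = C := mul_one C
    · rw [radialDensity_eq_zero zero_le_one (by simpa using h)]; simp
  · have h1 : HasDerivAt (fun S : ℝ => p + S • y) y S := by
      simpa using ((hasDerivAt_id S).smul_const y).const_add p
    have h2 := (hw.differentiable (by simp) (p + S • y)).hasFDerivAt.comp_hasDerivAt S h1
    exact h2.mul_const _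

/-- The weighted means of a weakly superharmonic function decrease with the radius: the derivative
of the mean is the weak Laplacian tested against a rescaled radial bump function. -/
theorem antitoneOn_radialMean {w : E → ℝ} (hw : ContDiff ℝ 1 w)
    (hsuper : ∀ φ : E → ℝ, ContDiff ℝ 1 φ → HasCompactSupport φ → (∀ x, 0 ≤ φ x) →
      0 ≤ ∫ x, fderiv ℝ φ x (gradient w x)) (p : E) :
    AntitoneOn (radialMean w p) (Ici 0) := by
  refine antitoneOn_of_deriv_nonpos (convex_Ici 0)
    (fun R _ => (hasDerivAt_radialMean hw p R).continuousAt.continuousWithinAt)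
    (fun R _ => (hasDerivAt_radialMean hw p R).differentiableAt.differentiableWithinAt) ?_
  intro R hR
  rw [interior_Ici, mem_Ioi] at hR
  rw [(hasDerivAt_radialMean hw p R).deriv]
  let A : E → E := fun x => R⁻¹ • (x - p)
  have hA : ContDiff ℝ 1 A := (contDiff_id.sub contDiff_const).const_smul _
  have hAd : ∀ x, HasFDerivAt A (R⁻¹ • ContinuousLinearMap.id ℝ E) x := fun x =>
    ((hasFDerivAt_id x).sub_const p).const_smul R⁻¹
  have hΦ := contDiff_radialBump (0 : E) 1
  let φ : E → ℝ := fun x => radialBump 0 1 (A x)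
  have hφ : ContDiff ℝ 1 φ := hΦ.comp hA
  have hφc : HasCompactSupport φ := by
    have h1 : HasCompactSupport fun x : E => radialBump (0 : E) 1 (R⁻¹ • x) :=
      (hasCompactSupport_radialBump (0 : E) zero_le_one).comp_smul (inv_ne_zero hR.ne')
    exact h1.comp_homeomorph (Homeomorph.subRight p)
  have h := hsuper φ hφ hφc fun x => radialBump_nonneg _ _ _
  let H : E → ℝ := fun y => fderiv ℝ w (p + R • y) y * radialDensity 0 1 y
  have e : ∀ x, fderiv ℝ φ x (gradient w x) = -R⁻¹ * H (R⁻¹ • (x - p)) := by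
    intro x
    have h1 : fderiv ℝ φ x = (fderiv ℝ (radialBump 0 1) (A x)).comp
        (R⁻¹ • ContinuousLinearMap.id ℝ E) :=
      ((hΦ.differentiable (by simp) (A x)).hasFDerivAt.comp x (hAd x)).fderiv
    rw [h1]
    simp only [ContinuousLinearMap.comp_apply, smul_apply, ContinuousLinearMap.id_apply,
      fderiv_radialBump, sub_zero, H, A, smul_inv_smul₀ hR.ne', add_sub_cancel,
      map_smul, smul_eq_mul]
    rw [real_inner_smul_left, real_inner_comm, inner_gradient_left]
    ring
  simp only [e] at h
  rw [integral_const_mul, integral_sub_right_eq_self (fun x => H (R⁻¹ • x)) p,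
    Measure.integral_comp_inv_smul_of_nonneg _ _ hR.le, smul_eq_mul] at h
  have hp : 0 < R⁻¹ * R ^ Module.finrank ℝ E := by positivity
  by_contra hcon
  rw [not_le] at hcon
  have := mul_pos hp hcon
  simp only [H] at h
  linarith

/-- The strong minimum principle on the whole space: a weakly superharmonic function that tends
to zero at infinity and vanishes at one point is zero. -/
theorem eq_zero_of_superharmonic [Nontrivial E] {w : E → ℝ} (hw : ContDiff ℝ 1 w)
    (hsuper : ∀ φ : E → ℝ, ContDiff ℝ 1 φ → HasCompactSupport φ → (∀ x, 0 ≤ φ x) →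
      0 ≤ ∫ x, fderiv ℝ φ x (gradient w x))
    (hlim : Tendsto w (cocompact E) (𝓝 0)) {p : E} (hp : w p = 0) (x : E) : w x = 0 := by
  have hη := continuous_radialDensity (0 : E) 1
  have hηc := hasCompactSupport_radialDensity (0 : E) zero_le_one
  have hηi := hη.integrable_of_hasCompactSupport (μ := volume) hηc
  set I := ∫ y : E, radialDensity (0 : E) 1 y with hI
  have hIpos : 0 < I := hη.integral_pos_of_hasCompactSupport_nonneg_nonzero hηc
    (radialDensity_nonneg _ _) (radialDensity_pos (x := 0) (by simp)).ne'
  obtain ⟨C, C0, hC⟩ := exists_bound_of_tendsto_cocompact hw.continuous hlim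
  have hF : ∀ q (S : ℝ), Continuous fun y => w (q + S • y) * radialDensity 0 1 y := fun q S =>
    (hw.continuous.comp (by fun_prop)).mul hη
  have hzero : ∀ q, radialMean w q 0 = w q * I := fun q => by
    simp [radialMean, integral_const_mul, hI]
  have htend : ∀ q, Tendsto (radialMean w q) atTop (𝓝 0) := by
    intro q
    rw [show (0 : ℝ) = ∫ _ : E, (0 : ℝ) by simp]
    refine tendsto_integral_filter_of_dominated_convergence
      (fun y => C * radialDensity 0 1 y) ?_ ?_ (hηi.const_mul C) ?_
    · exact Eventually.of_forall fun S => (hF q S).aestronglyMeasurable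
    · refine Eventually.of_forall fun S => Eventually.of_forall fun y => ?_
      rw [norm_mul, Real.norm_of_nonneg (radialDensity_nonneg _ _ _), Real.norm_eq_abs]
      exact mul_le_mul_of_nonneg_right (hC _) (radialDensity_nonneg _ _ _)
    · have hne : ∀ᵐ y : E, y ≠ 0 := by
        rw [ae_iff]; simp
      filter_upwards [hne] with y hy
      have h1 : Tendsto (fun R : ℝ => q + R • y) atTop (cocompact E) := by
        have := (Homeomorph.addLeft q).isClosedEmbedding.tendsto_cocompact
        exact this.comp (tendsto_smul_cocompact hy)
      simpa using (hlim.comp h1).mul_const (radialDensity 0 1 y)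
  have hanti : ∀ q, AntitoneOn (radialMean w q) (Ici 0) := antitoneOn_radialMean hw hsuper
  have hMnn : ∀ q (S : ℝ), 0 ≤ S → 0 ≤ radialMean w q S := by
    intro q S hS
    refine le_of_tendsto (htend q) ?_
    filter_upwards [eventually_ge_atTop S] with T hT
    exact hanti q hS (hS.trans hT) hT
  have hnn : ∀ q, 0 ≤ w q := by
    intro q
    have := hMnn q 0 le_rfl
    rw [hzero] at this
    exact nonneg_of_mul_nonneg_left this hIpos
  -- at the zero `p` all means vanish, in particular one over a ball that contains `x`
  set S := ‖x - p‖ + 1 with hS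
  have hS0 : 0 < S := by positivity
  have hM0 : radialMean w p S = 0 := by
    refine le_antisymm ?_ (hMnn p S hS0.le)
    have := hanti p (mem_Ici.2 le_rfl) (mem_Ici.2 hS0.le) hS0.le
    rwa [hzero, hp, zero_mul] at this
  by_contra hne
  have hy : p + S • (S⁻¹ • (x - p)) = x := by rw [smul_inv_smul₀ hS0.ne']; abel
  have hpos : 0 < radialDensity (0 : E) 1 (S⁻¹ • (x - p)) := by
    refine radialDensity_pos ?_
    rw [sub_zero, norm_smul, norm_inv, Real.norm_of_nonneg hS0.le, inv_mul_lt_iff₀ hS0]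
    linarith
  have := (hF p S).integral_pos_of_hasCompactSupport_nonneg_nonzero (μ := volume)
    hηc.mul_left (fun y => mul_nonneg (hnn _) (radialDensity_nonneg _ _ _))
    (x := S⁻¹ • (x - p)) (by rw [hy]; exact mul_ne_zero hne hpos.ne')
  exact this.ne' hM0

/-- A function whose gradient vanishes on a plane and that tends to `1` at infinity is `1` on the
plane. -/
theorem eq_one_on_plane (hdim : Module.finrank ℝ E = 3) {ψ : E → ℝ} (hψ : ContDiff ℝ 1 ψ)
    (hlim : Tendsto ψ (cocompact E) (𝓝 1))
    (hgrad : ∀ x, height a n x = 0 → gradient ψ x = 0) {p : E} (hp : height a n p = 0) :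
    ψ p = 1 := by
  obtain ⟨v, hv, hv0⟩ : ∃ v : E, inner ℝ n v = 0 ∧ v ≠ 0 := by
    by_contra! hcon
    have h1 : (Submodule.span ℝ {n})ᗮ = ⊥ := by
      rw [Submodule.eq_bot_iff]
      exact fun v hv => hcon v (Submodule.mem_orthogonal_singleton_iff_inner_right.1 hv)
    have h2 : Submodule.span ℝ {n} = ⊤ := (Submodule.orthogonal_eq_bot_iff).1 h1
    have h3 := finrank_span_le_card (R := ℝ) ({n} : Set E)
    rw [h2, finrank_top, hdim] at h3
    simp at h3
  have hpl : ∀ t : ℝ, height a n (p + t • v) = 0 := fun t => by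
    have : p + t • v - a = (p - a) + t • v := by abel
    rw [height, this, inner_add_right, inner_smul_right, hv, mul_zero, add_zero]
    exact hp
  have hd : ∀ t : ℝ, HasDerivAt (fun t : ℝ => ψ (p + t • v)) 0 t := by
    intro t
    have h1 : HasDerivAt (fun S : ℝ => p + S • v) v t := by
      simpa using ((hasDerivAt_id t).smul_const v).const_add p
    have h2 := (hψ.differentiable (by simp) (p + t • v)).hasFDerivAt.comp_hasDerivAt t h1
    have h3 : fderiv ℝ ψ (p + t • v) v = 0 := by
      rw [← inner_gradient_left, hgrad _ (hpl t), inner_zero_left]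
    rwa [h3] at h2
  have hconst : ∀ t : ℝ, ψ (p + t • v) = ψ p := by
    intro t
    have := is_const_of_deriv_eq_zero (fun t => (hd t).differentiableAt)
      (fun t => (hd t).deriv) t 0
    simpa using this
  have h1 : Tendsto (fun t : ℝ => p + t • v) atTop (cocompact E) :=
    (Homeomorph.addLeft p).isClosedEmbedding.tendsto_cocompact.comp (tendsto_smul_cocompact hv0)
  have h2 := hlim.comp h1
  exact tendsto_nhds_unique (tendsto_const_nhds.congr fun t => (hconst t).symm) h2

/-- If `Δψ = m ≥ 0`, and `ψ = 1` and `∇ψ = 0` on a plane, then `ψ = 1` on one side of it.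
Extended by zero to the other side, `1 - ψ` is of class `C¹` and weakly superharmonic on the whole
space, so the strong minimum principle takes the place of Hopf's boundary point lemma. -/
theorem IsWeakPoisson.eq_one_of_cauchy_data (hdim : Module.finrank ℝ E = 3) {ψ m : E → ℝ}
    (hw : IsWeakPoisson ψ m) (hψ : ContDiff ℝ 1 ψ) (hlim : Tendsto ψ (cocompact E) (𝓝 1))
    (hmnn : ∀ x, 0 ≤ m x) (hn : ‖n‖ = 1)
    (hone : ∀ x, height a n x = 0 → ψ x = 1)
    (hgrad : ∀ x, height a n x = 0 → gradient ψ x = 0) {x : E} (hx : 0 < height a n x) :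
    ψ x = 1 := by
  have hE : Nontrivial E := Module.nontrivial_of_finrank_pos (R := ℝ) (by rw [hdim]; norm_num)
  have hh : Continuous (height a n) := (contDiff_height (k := 0)).continuous
  have hDψ := hψ.continuous_fderiv (n := 1) (by simp)
  let H : Set E := {x | 0 < height a n x}
  have hfr : frontier H ⊆ {x | height a n x = 0} := by
    intro y hy
    have := frontier_lt_subset_eq continuous_const hh hy
    exact (show 0 = height a n y from this).symm
  classical
  let w : E → ℝ := H.piecewise (fun x => 1 - ψ x) fun _ => 0
  let w' : E → E →L[ℝ] ℝ := H.piecewise (fun x => -fderiv ℝ ψ x) fun _ => 0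
  have hD0 : ∀ x, height a n x = 0 → fderiv ℝ ψ x = 0 := fun x hx => by
    rw [← toDual_gradient, hgrad x hx, map_zero]
  have hw'c : Continuous w' :=
    continuous_piecewise (fun x hx => by simp [hD0 x (hfr hx)]) hDψ.neg.continuousOn
      continuousOn_const
  have hwd : ∀ x, HasFDerivAt w (w' x) x := by
    intro x
    rcases lt_trichotomy (height a n x) 0 with h | h | h
    · have e1 : w =ᶠ[𝓝 x] fun _ => 0 := by
        filter_upwards [(isOpen_lt hh continuous_const).mem_nhds h] with y hy
        exact piecewise_eq_of_notMem _ _ _ (not_lt.2 (le_of_lt hy))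
      have e2 : w' x = 0 := piecewise_eq_of_notMem _ _ _ (not_lt.2 h.le)
      rw [e2]
      exact (hasFDerivAt_const (0 : ℝ) x).congr_of_eventuallyEq e1
    · have e2 : w' x = 0 := piecewise_eq_of_notMem _ _ _ (not_lt.2 h.le)
      have e3 : w x = 0 := piecewise_eq_of_notMem _ _ _ (not_lt.2 h.le)
      have h1 := (hψ.differentiable (by simp) x).hasFDerivAt.isLittleO
      rw [e2]
      refine HasFDerivAt.of_isLittleO ?_
      refine Asymptotics.IsBigO.trans_isLittleO ?_ h1
      refine Asymptotics.IsBigO.of_bound 1 (Eventually.of_forall fun y => ?_)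
      simp only [e3, hD0 x h, zero_apply, sub_zero, hone x h, one_mul]
      by_cases hy : y ∈ H
      · rw [show w y = 1 - ψ y from piecewise_eq_of_mem _ _ _ hy, norm_sub_rev]
      · rw [show w y = 0 from piecewise_eq_of_notMem _ _ _ hy, norm_zero]
        exact norm_nonneg _
    · have e1 : w =ᶠ[𝓝 x] fun y => 1 - ψ y := by
        filter_upwards [(isOpen_lt continuous_const hh).mem_nhds h] with y hy
        exact piecewise_eq_of_mem _ _ _ hy
      have e2 : w' x = -fderiv ℝ ψ x := piecewise_eq_of_mem _ _ _ h
      rw [e2]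
      exact ((hψ.differentiable (by simp) x).hasFDerivAt.const_sub 1).congr_of_eventuallyEq e1
  have hwC : ContDiff ℝ 1 w := contDiff_one_iff_hasFDerivAt.2 ⟨w', hw'c, hwd⟩
  have hwlim : Tendsto w (cocompact E) (𝓝 0) := by
    have h1 : Tendsto (fun x => |1 - ψ x|) (cocompact E) (𝓝 0) := by
      simpa using (hlim.const_sub 1).abs
    refine squeeze_zero_norm (fun y => ?_) h1
    by_cases hy : y ∈ H
    · rw [show w y = 1 - ψ y from piecewise_eq_of_mem _ _ _ hy, Real.norm_eq_abs]
    · rw [show w y = 0 from piecewise_eq_of_notMem _ _ _ hy, norm_zero]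
      exact abs_nonneg _
  have hsuper : ∀ φ : E → ℝ, ContDiff ℝ 1 φ → HasCompactSupport φ → (∀ x, 0 ≤ φ x) →
      0 ≤ ∫ x, fderiv ℝ φ x (gradient w x) := by
    intro φ hφ hφc hφ0
    have hDc := continuous_fderiv_gradient hφ hψ
    have hDs : HasCompactSupport fun x => fderiv ℝ φ x (gradient ψ x) :=
      (hφc.fderiv (𝕜 := ℝ)).mono fun x hx hx' => hx (by simp [hx'])
    have e : ∀ x, fderiv ℝ φ x (gradient w x)
        = -H.indicator (fun x => fderiv ℝ φ x (gradient ψ x)) x := by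
      intro x
      rw [fderiv_gradient_comm, (hwd x).fderiv]
      by_cases hy : x ∈ H
      · rw [show w' x = -fderiv ℝ ψ x from piecewise_eq_of_mem _ _ _ hy, indicator_of_mem hy,
          fderiv_gradient_comm φ, neg_apply]
      · rw [show w' x = 0 from piecewise_eq_of_notMem _ _ _ hy, indicator_of_notMem hy]
        simp
    simp only [e]
    rw [integral_neg, integral_indicator measurableSet_halfSpace, neg_nonneg]
    have hfc : Continuous fun x => φ x * fderiv ℝ ψ x n :=
      hφ.continuous.mul (continuous_fderiv_const hψ n)
    have hfs : HasCompactSupport fun x => φ x * fderiv ℝ ψ x n := hφc.mul_right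
    have t1 := tendsto_integral_step_mul (a := a) (n := n)
      (hDc.integrable_of_hasCompactSupport (μ := volume) hDs)
    have t2 := (tendsto_integral_layer_mul (a := a) hn hfc hfs fun x hx => by
      simp [hD0 x hx]).neg
    rw [neg_zero] at t2
    refine le_of_tendsto_of_tendsto t1 t2 ?_
    filter_upwards [self_mem_nhdsWithin] with δ hδ
    have hs := contDiff_step (a := a) (n := n) δ
    have hk := hw (fun x => step a n δ x * φ x) (hs.mul hφ) hφc.mul_left
    have e2 : ∀ x, fderiv ℝ (fun x => step a n δ x * φ x) x (gradient ψ x)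
        = step a n δ x * fderiv ℝ φ x (gradient ψ x)
          + layer a n δ x * (φ x * fderiv ℝ ψ x n) := by
      intro x
      rw [fderiv_fun_mul (hs.differentiable (by simp) x) (hφ.differentiable (by simp) x)]
      simp only [add_apply, smul_apply, smul_eq_mul, fderiv_step]
      rw [show inner ℝ n (gradient ψ x) = fderiv ℝ ψ x n by
        rw [real_inner_comm, inner_gradient_left]]
      ring
    simp only [e2] at hk
    have i1 : Integrable fun x => step a n δ x * fderiv ℝ φ x (gradient ψ x) :=
      (hs.continuous.mul hDc).integrable_of_hasCompactSupport hDs.mul_left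
    have i2 : Integrable fun x => layer a n δ x * (φ x * fderiv ℝ ψ x n) :=
      ((continuous_layer δ).mul hfc).integrable_of_hasCompactSupport hfs.mul_left
    rw [integral_add i1 i2] at hk
    have : 0 ≤ ∫ x, m x * (step a n δ x * φ x) := integral_nonneg fun x =>
      mul_nonneg (hmnn x) (mul_nonneg (step_nonneg _ _) (hφ0 x))
    linarith
  have hwa : w a = 0 := piecewise_eq_of_notMem _ _ _ (by simp [H, height])
  have hwx := eq_zero_of_superharmonic hwC hsuper hwlim hwa x
  rw [show w x = 1 - ψ x from piecewise_eq_of_mem _ _ _ hx] at hwx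
  linarith

end Superharmonic

/-! ### The divergence theorem on smooth bodies -/

section Divergence

theorem continuous_pderiv {f : E3 → ℝ} (hf : ContDiff ℝ 1 f) (i : Fin 3) :
    Continuous (pderiv i f) := continuous_fderiv_const hf _

theorem hasCompactSupport_pderiv {f : E3 → ℝ} (hf : HasCompactSupport f) (i : Fin 3) :
    HasCompactSupport (pderiv i f) := hf.fderiv_apply (𝕜 := ℝ) _

theorem pderiv_eq_zero_of_notMem_tsupport {f : E3 → ℝ} {x : E3} (hx : x ∉ tsupport f)
    (i : Fin 3) : pderiv i f x = 0 := by
  rw [pderiv, fderiv_eq_zero_of_notMem_tsupport hx, zero_apply]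

theorem pderiv_mul {f g : E3 → ℝ} {x : E3} (hf : DifferentiableAt ℝ f x)
    (hg : DifferentiableAt ℝ g x) (i : Fin 3) :
    pderiv i (fun y => f y * g y) x = f x * pderiv i g x + g x * pderiv i f x := by
  rw [pderiv, fderiv_fun_mul hf hg]; rfl

theorem pderiv_eq_gradient (f : E3 → ℝ) (x : E3) (i : Fin 3) : pderiv i f x = gradient f x i := by
  rw [pderiv, ← inner_gradient_left, real_inner_comm, EuclideanSpace.inner_single_left]
  simp

theorem fderiv_apply_eq_sum_pderiv (f : E3 → ℝ) (x v : E3) :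
    fderiv ℝ f x v = ∑ j, v j * pderiv j f x := by
  rw [← inner_gradient_left, PiLp.inner_apply]
  simp [pderiv_eq_gradient]

/-- The integrand `q div f + f · ∇q = div (q f)`. -/
def divMul (f : Fin 3 → E3 → ℝ) (q : E3 → ℝ) (x : E3) : ℝ :=
  q x * ∑ j, pderiv j (f j) x + ∑ j, f j x * pderiv j q x

variable {Ω : Set E3} {f : Fin 3 → E3 → ℝ}

theorem integrableOn_divMul (hΩb : Bornology.IsBounded Ω) (hΩ : MeasurableSet Ω)
    (hfc : ∀ j, ContinuousOn (f j) (closure Ω))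
    (hint : IntegrableOn (fun x => ∑ j, pderiv j (f j) x) Ω) {q : E3 → ℝ} (hq : ContDiff ℝ 1 q) :
    IntegrableOn (divMul f q) Ω := by
  have hK : IsCompact (closure Ω) := hΩb.isCompact_closure
  obtain ⟨C, -, hC⟩ := exists_pos_bound_on_compact hK hq.continuous.continuousOn
  refine Integrable.add ?_ ?_
  · refine Integrable.bdd_mul hint hq.continuous.aestronglyMeasurable (c := C) ?_
    exact (ae_restrict_mem hΩ).mono fun x hx => hC x (subset_closure hx)
  · have h : ContinuousOn (fun x => ∑ j, f j x * pderiv j q x) (closure Ω) :=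
      continuousOn_finsetSum _ fun j _ => (hfc j).mul (continuous_pderiv hq j).continuousOn
    exact (h.integrableOn_compact hK).mono_set subset_closure

/-- The divergence theorem for a test function supported inside `Ω`. -/
theorem integral_divMul_of_tsupport_subset (hΩ : IsOpen Ω)
    (hf : ∀ j, ContDiffOn ℝ 1 (f j) Ω) {q : E3 → ℝ} (hq : ContDiff ℝ 1 q)
    (hc : HasCompactSupport q) (hs : tsupport q ⊆ Ω) : ∫ x in Ω, divMul f q x = 0 := by
  have hg : ∀ j, ContDiff ℝ 1 fun x => q x * f j x := by
    intro j
    refine contDiff_iff_contDiffAt.2 fun x => ?_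
    by_cases hx : x ∈ tsupport q
    · exact hq.contDiffAt.mul ((hf j).contDiffAt (hΩ.mem_nhds (hs hx)))
    · have : (fun x => q x * f j x) =ᶠ[𝓝 x] fun _ => 0 := by
        filter_upwards [(isClosed_tsupport q).isOpen_compl.mem_nhds hx] with y hy
        rw [image_eq_zero_of_notMem_tsupport hy, zero_mul]
      exact contDiffAt_const.congr_of_eventuallyEq this
  have hgc : ∀ j, HasCompactSupport fun x => q x * f j x := fun j => hc.mul_right
  have e : ∀ x, divMul f q x = ∑ j, pderiv j (fun x => q x * f j x) x := by
    intro x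
    rw [divMul, Finset.mul_sum, ← Finset.sum_add_distrib]
    refine Finset.sum_congr rfl fun j _ => ?_
    by_cases hx : x ∈ tsupport q
    · rw [pderiv_mul (hq.differentiable (by simp) x)
        (((hf j).contDiffAt (hΩ.mem_nhds (hs hx))).differentiableAt (by simp))]
    · have h2 : x ∉ tsupport fun x => q x * f j x := fun h => hx (tsupport_mul_subset_left h)
      rw [pderiv_eq_zero_of_notMem_tsupport h2, image_eq_zero_of_notMem_tsupport hx,
        pderiv_eq_zero_of_notMem_tsupport hx]
      simp
  have h0 : ∀ x, x ∉ Ω → divMul f q x = 0 := by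
    intro x hx
    have hx' : x ∉ tsupport q := fun h => hx (hs h)
    simp [divMul, image_eq_zero_of_notMem_tsupport hx', pderiv_eq_zero_of_notMem_tsupport hx']
  rw [setIntegral_eq_integral_of_forall_compl_eq_zero h0]
  simp only [e]
  rw [integral_finsetSum _ fun j _ => (continuous_pderiv (hg j) j).integrable_of_hasCompactSupport
    (hasCompactSupport_pderiv (hgc j) j)]
  exact Finset.sum_eq_zero fun j _ => integral_fderiv_apply_eq_zero (hg j) (hgc j) _

/-- Near a boundary point, `Ω` is `{ρ < 0}` for a function `ρ` that is `C¹` on the whole space and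
strictly increasing in a fixed direction `e`. -/
theorem exists_defining_function (hΩ : HasSmoothBoundary Ω) {p : E3} (hp : p ∈ frontier Ω) :
    ∃ (ρ : E3 → ℝ) (r : ℝ) (e : E3) (μ : ℝ), ContDiff ℝ 1 ρ ∧ 0 < r ∧ 0 < μ ∧
      (∀ x ∈ Metric.ball p r, (x ∈ Ω ↔ ρ x < 0)) ∧
      (∀ x ∈ Metric.ball p r, μ ≤ fderiv ℝ ρ x e) ∧
      ∀ x ∈ Metric.ball p r, x ∈ frontier Ω →
        IsOutwardUnitNormal Ω x (‖gradient ρ x‖⁻¹ • gradient ρ x) := by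
  obtain ⟨ρ₀, V, hV, hpV, hρ₀, hΩρ, hgr⟩ := hΩ p hp
  obtain ⟨s, hs, hsV⟩ := Metric.isOpen_iff.1 hV p hpV
  let χ : ContDiffBump p := ⟨s / 3, s / 2, by positivity, by linarith⟩
  have hχV : tsupport χ ⊆ V := by
    rw [χ.tsupport_eq]
    exact (Metric.closedBall_subset_ball (show s / 2 < s by linarith)).trans hsV
  let ρ : E3 → ℝ := fun x => χ x * ρ₀ x
  have hρ : ContDiff ℝ 1 ρ := by
    refine contDiff_iff_contDiffAt.2 fun x => ?_
    by_cases hx : x ∈ tsupport χ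
    · exact χ.contDiff.contDiffAt.mul
        (((hρ₀.contDiffAt (hV.mem_nhds (hχV hx)))).of_le (by exact_mod_cast le_top))
    · have : ρ =ᶠ[𝓝 x] fun _ => 0 := by
        filter_upwards [(isClosed_tsupport χ).isOpen_compl.mem_nhds hx] with y hy
        simp only [ρ]
        rw [image_eq_zero_of_notMem_tsupport hy, zero_mul]
      exact contDiffAt_const.congr_of_eventuallyEq this
  have hbV : Metric.ball p (s / 3) ⊆ V :=
    (Metric.ball_subset_ball (by linarith)).trans hsV
  have heq : ∀ x ∈ Metric.ball p (s / 3), ρ x = ρ₀ x := fun x hx => by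
    simp only [ρ]
    rw [χ.one_of_mem_closedBall (Metric.ball_subset_closedBall hx), one_mul]
  have hpe : gradient ρ p = gradient ρ₀ p := by
    have : ρ =ᶠ[𝓝 p] ρ₀ := by
      filter_upwards [Metric.ball_mem_nhds p (show 0 < s / 3 by positivity)] with y hy
      exact heq y hy
    exact this.gradient_eq
  rw [← hpe] at hgr
  have hgp : 0 < ‖gradient ρ p‖ := norm_pos_iff.2 hgr
  have hev : ∀ᶠ x in 𝓝 p, ‖gradient ρ p‖ ^ 2 / 2 < fderiv ℝ ρ x (gradient ρ p) :=
    (continuous_fderiv_const hρ _).continuousAt.eventually (lt_mem_nhds (by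
      show ‖gradient ρ p‖ ^ 2 / 2 < fderiv ℝ ρ p (gradient ρ p)
      rw [fderiv_gradient_self]
      linarith [pow_pos hgp 2]))
  obtain ⟨r, r0, hr⟩ := Metric.eventually_nhds_iff_ball.1 hev
  have hin : Metric.ball p (min r (s / 3)) ⊆ Metric.ball p (s / 3) :=
    Metric.ball_subset_ball (min_le_right _ _)
  refine ⟨ρ, min r (s / 3), gradient ρ p, ‖gradient ρ p‖ ^ 2 / 2, hρ, by positivity,
    by positivity, fun x hx => ?_, fun x hx => ?_, fun x hx hxf => ?_⟩
  · rw [heq x (hin hx)]; exact hΩρ x (hbV (hin hx))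
  · exact (hr x (Metric.ball_subset_ball (min_le_left _ _) hx)).le
  · refine ⟨hxf, ρ, ⟨Metric.ball p (s / 3), Metric.isOpen_ball, hin hx, ?_, ?_, ?_⟩, rfl⟩
    · exact (hρ₀.mono hbV).congr heq
    · intro y hy
      rw [heq y hy]; exact hΩρ y (hbV hy)
    · intro h0
      have := hr x (Metric.ball_subset_ball (min_le_left _ _) hx)
      rw [← inner_gradient_left, h0, inner_zero_left] at this
      linarith [pow_pos hgp 2]

/-- The divergence theorem for a test function supported near a boundary point. The test function
is multiplied by a cutoff of width `δ` along the boundary, whose gradient points in the normal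
direction. There the traction is small, and the total mass of the gradient stays bounded because
it can be integrated by parts in the direction `e`. -/
theorem exists_ball_integral_divMul_eq_zero (hΩ : IsBody Ω)
    (hf : ∀ j, ContDiffOn ℝ 1 (f j) Ω) (hfc : ∀ j, ContinuousOn (f j) (closure Ω))
    (hint : IntegrableOn (fun x => ∑ j, pderiv j (f j) x) Ω)
    (htr : ∀ p ν, IsOutwardUnitNormal Ω p ν → ∑ j, f j p * ν j = 0) {p : E3}
    (hp : p ∈ frontier Ω) :
    ∃ r, 0 < r ∧ ∀ q : E3 → ℝ, ContDiff ℝ 1 q → tsupport q ⊆ Metric.ball p r →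
      ∫ x in Ω, divMul f q x = 0 := by
  obtain ⟨ρ, r, e, μ, hρ, r0, μ0, hΩρ, hmon, hnor⟩ :=
    exists_defining_function hΩ.smoothBoundary hp
  refine ⟨r / 2, by positivity, fun q hq hqs => ?_⟩
  have hΩm : MeasurableSet Ω := hΩ.isOpen.measurableSet
  have hqB : tsupport q ⊆ Metric.ball p r := hqs.trans (Metric.ball_subset_ball (by linarith))
  have hqc : HasCompactSupport q :=
    (isCompact_closedBall p (r / 2)).of_isClosed_subset (isClosed_tsupport q)
      (hqs.trans Metric.ball_subset_closedBall)
  have hKc : IsCompact (tsupport q ∩ closure Ω) := hqc.isCompact.inter_right isClosed_closure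
  -- a multiple of the traction at boundary points
  let G : E3 → ℝ := fun x => ∑ j, f j x * pderiv j ρ x
  have hGc : ContinuousOn G (closure Ω) :=
    continuousOn_finsetSum _ fun j _ => (hfc j).mul (continuous_pderiv hρ j).continuousOn
  have hρle : ∀ x ∈ Metric.ball p r, x ∈ closure Ω → ρ x ≤ 0 := by
    intro x hx hxc
    by_contra hcon
    rw [not_le] at hcon
    obtain ⟨y, ⟨hy1, hy2⟩, hy3⟩ := mem_closure_iff.1 hxc
      (Metric.ball p r ∩ {y | 0 < ρ y})
      (Metric.isOpen_ball.inter (isOpen_lt continuous_const hρ.continuous)) ⟨hx, hcon⟩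
    have := (hΩρ y hy1).1 hy3
    exact lt_asymm this hy2
  have hG0 : ∀ x ∈ Metric.ball p r, x ∈ closure Ω → ρ x = 0 → G x = 0 := by
    intro x hx hxc h0
    have hxn : x ∉ Ω := fun h => by
      have := (hΩρ x hx).1 h
      linarith
    have hxf : x ∈ frontier Ω := ⟨hxc, fun h => hxn (interior_subset h)⟩
    have h1 := htr x _ (hnor x hx hxf)
    have hne : gradient ρ x ≠ 0 := fun h => by
      have := hmon x hx
      rw [← inner_gradient_left, h, inner_zero_left] at this
      linarith
    have h2 : ∑ j, f j x * (‖gradient ρ x‖⁻¹ • gradient ρ x) j = ‖gradient ρ x‖⁻¹ * G x := by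
      simp only [G, Finset.mul_sum, pderiv_eq_gradient, PiLp.smul_apply, smul_eq_mul]
      exact Finset.sum_congr rfl fun j _ => by ring
    rw [h2] at h1
    exact (mul_eq_zero.1 h1).resolve_left (inv_ne_zero (norm_ne_zero_iff.2 hne))
  have hsmall : ∀ ε, 0 < ε → ∃ c, 0 < c ∧ ∀ x ∈ tsupport q, x ∈ closure Ω → -c < ρ x →
      |G x| ≤ ε := by
    intro ε hε
    let K' : Set E3 := (tsupport q ∩ closure Ω) ∩ (fun x => |G x|) ⁻¹' (Ici ε)
    have hK' : IsCompact K' := by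
      refine hKc.of_isClosed_subset ?_ inter_subset_left
      exact ((hGc.mono inter_subset_right).abs).preimage_isClosed_of_isClosed hKc.isClosed
        isClosed_Ici
    rcases K'.eq_empty_or_nonempty with h | h
    · refine ⟨1, one_pos, fun x h1 h2 _ => ?_⟩
      by_contra hcon
      have : x ∈ K' := ⟨⟨h1, h2⟩, (not_le.1 hcon).le⟩
      rw [h] at this
      exact this
    · obtain ⟨z, hz, hmax⟩ := hK'.exists_isMaxOn h hρ.continuous.continuousOn
      have hz1 := hρle z (hqB hz.1.1) hz.1.2
      have hz2 : ρ z ≠ 0 := fun h0 => by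
        have h3 : ε ≤ |G z| := hz.2
        rw [hG0 z (hqB hz.1.1) hz.1.2 h0, abs_zero] at h3
        linarith
      refine ⟨-ρ z, neg_pos.2 (lt_of_le_of_ne hz1 hz2), fun x h1 h2 h3 => ?_⟩
      by_contra hcon
      have : ρ x ≤ ρ z := hmax (show x ∈ K' from ⟨⟨h1, h2⟩, (not_le.1 hcon).le⟩)
      linarith
  -- `h δ` is `0` where `ρ ≥ -δ` and `1` where `ρ ≤ -2δ`; its gradient is `-lam δ • ∇ρ`
  let T := Real.smoothTransition
  let h : ℝ → E3 → ℝ := fun δ x => T (-ρ x / δ - 1)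
  let lam : ℝ → E3 → ℝ := fun δ x => deriv T (-ρ x / δ - 1) / δ
  have hh : ∀ δ, ContDiff ℝ 1 (h δ) := fun δ =>
    (Real.smoothTransition.contDiff (n := 1)).comp ((hρ.neg.div_const δ).sub contDiff_const)
  have hlamc : ∀ δ, Continuous (lam δ) := fun δ => by
    have h1 : Continuous (deriv T) :=
      (Real.smoothTransition.contDiff (n := 1)).continuous_deriv le_rfl
    exact (h1.comp ((hρ.continuous.neg.div_const δ).sub continuous_const)).div_const δ
  have hlam0 : ∀ δ, 0 < δ → ∀ x, 0 ≤ lam δ x := fun δ hδ x =>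
    div_nonneg Real.smoothTransition.monotone.deriv_nonneg hδ.le
  have hlamz : ∀ δ, 0 < δ → ∀ x, ρ x < -(2 * δ) → lam δ x = 0 := by
    intro δ hδ x hx
    have : T =ᶠ[𝓝 (-ρ x / δ - 1)] fun _ => 1 := by
      have h1 : 1 < -ρ x / δ - 1 := by
        rw [lt_sub_iff_add_lt, lt_div_iff₀ hδ]; linarith
      filter_upwards [lt_mem_nhds h1] with t ht
      exact Real.smoothTransition.one_of_one_le ht.le
    simp only [lam]
    rw [this.deriv_eq]; simp
  have hdh : ∀ δ x v, fderiv ℝ (h δ) x v = -(lam δ x * fderiv ℝ ρ x v) := by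
    intro δ x v
    have h1 : HasDerivAt T (deriv T (-ρ x / δ - 1)) (-ρ x / δ - 1) :=
      ((Real.smoothTransition.contDiff (n := 1)).differentiable (by simp) _).hasDerivAt
    have h2 : HasFDerivAt (fun y => -ρ y / δ - 1) (δ⁻¹ • -fderiv ℝ ρ x) x := by
      have := ((hρ.differentiable (by simp) x).hasFDerivAt.fun_neg.mul_const δ⁻¹).sub_const 1
      simpa only [div_eq_mul_inv] using this
    have h3 := h1.comp_hasFDerivAt x h2
    rw [show fderiv ℝ (h δ) x = _ from h3.fderiv]
    simp only [smul_apply, smul_eq_mul, neg_apply, lam]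
    ring
  -- by `μ ≤ ∂ₑρ`, the mass of `lam δ` is at most that of `-∂ₑ(h δ) / μ`, bounded by parts
  let b : ContDiffBump p := ⟨r / 2, 3 * r / 4, by positivity, by linarith⟩
  have hb : ContDiff ℝ 1 b := b.contDiff
  have hbs : tsupport b ⊆ Metric.ball p r := by
    rw [b.tsupport_eq]
    exact Metric.closedBall_subset_ball (show 3 * r / 4 < r by linarith)
  set I := ∫ x, |fderiv ℝ b x e| with hI
  have hI0 : 0 ≤ I := integral_nonneg fun x => abs_nonneg _
  have hDb : Continuous fun x => fderiv ℝ b x e := continuous_fderiv_const hb e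
  have hDbc : HasCompactSupport fun x => fderiv ℝ b x e :=
    b.hasCompactSupport.fderiv_apply (𝕜 := ℝ) e
  have hmassint : ∀ δ, Integrable fun x => b x * lam δ x := fun δ =>
    (b.continuous.mul (hlamc δ)).integrable_of_hasCompactSupport b.hasCompactSupport.mul_right
  have hmass : ∀ δ, 0 < δ → μ * ∫ x, b x * lam δ x ≤ I := by
    intro δ hδ
    have h1 := integral_mul_fderiv_eq_neg (hh δ) hb b.hasCompactSupport e
    have h2 : μ * ∫ x, b x * lam δ x ≤ ∫ x, -(b x * fderiv ℝ (h δ) x e) := by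
      rw [← integral_const_mul]
      refine integral_mono ((hmassint δ).const_mul _)
        ((b.continuous.mul (continuous_fderiv_const (hh δ) e)).integrable_of_hasCompactSupport
          b.hasCompactSupport.mul_right).neg fun x => ?_
      simp only [hdh]
      by_cases hx : x ∈ tsupport b
      · have h3 := hmon x (hbs hx)
        have h4 := mul_le_mul_of_nonneg_left h3
          (mul_nonneg (b.nonneg' x) (hlam0 δ hδ x))
        linarith
      · rw [image_eq_zero_of_notMem_tsupport hx]; simp
    rw [integral_neg, ← h1] at h2
    refine h2.trans (integral_mono (((hh δ).continuous.mul
      hDb).integrable_of_hasCompactSupport hDbc.mul_left)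
      (hDb.integrable_of_hasCompactSupport hDbc).abs fun x => ?_)
    refine (le_abs_self _).trans ?_
    rw [abs_mul, abs_of_nonneg (Real.smoothTransition.nonneg _)]
    exact mul_le_of_le_one_left (abs_nonneg _) (Real.smoothTransition.le_one _)
  obtain ⟨C, C0, hC⟩ := exists_pos_bound_on_compact hqc.isCompact hq.continuous.continuousOn
  have hqb : ∀ x, |q x| ≤ C * b x := by
    intro x
    by_cases hx : x ∈ tsupport q
    · rw [b.one_of_mem_closedBall (Metric.ball_subset_closedBall (hqs hx)), mul_one]
      exact hC x hx
    · rw [image_eq_zero_of_notMem_tsupport hx, abs_zero]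
      exact mul_nonneg C0.le (b.nonneg' x)
  have hA := integrableOn_divMul hΩ.isBounded hΩm hfc hint hq
  -- `q * h δ` is supported inside `Ω`
  have hid : ∀ δ, 0 < δ →
      ∫ x in Ω, h δ x * divMul f q x = ∫ x in Ω, q x * lam δ x * G x := by
    intro δ hδ
    have hqh : ContDiff ℝ 1 fun x => q x * h δ x := hq.mul (hh δ)
    have hsub : tsupport (fun x => q x * h δ x) ⊆ Ω := by
      intro x hx
      by_contra hxn
      have hxq : x ∈ tsupport q := tsupport_mul_subset_left hx
      have hρx : 0 ≤ ρ x := by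
        by_contra hcon
        exact hxn ((hΩρ x (hqB hxq)).2 (not_le.1 hcon))
      refine (notMem_tsupport_iff_eventuallyEq.2 ?_) hx
      have : ∀ᶠ y in 𝓝 x, -δ < ρ y :=
        hρ.continuous.continuousAt.eventually (lt_mem_nhds (by linarith))
      filter_upwards [this] with y hy
      have : h δ y = 0 := Real.smoothTransition.zero_of_nonpos (by
        rw [sub_nonpos, div_le_one hδ]; linarith)
      rw [this, mul_zero]; rfl
    have h0 := integral_divMul_of_tsupport_subset hΩ.isOpen hf hqh hqc.mul_right hsub
    have e1 : ∀ x, divMul f (fun x => q x * h δ x) x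
        = h δ x * divMul f q x - q x * lam δ x * G x := by
      intro x
      have e2 : ∀ j, f j x * pderiv j (fun x => q x * h δ x) x
          = h δ x * (f j x * pderiv j q x) - q x * lam δ x * (f j x * pderiv j ρ x) := by
        intro j
        rw [pderiv_mul (hq.differentiable (by simp) x) ((hh δ).differentiable (by simp) x),
          show pderiv j (h δ) x = -(lam δ x * pderiv j ρ x) from hdh δ x _]
        ring
      simp only [divMul, e2, G, Finset.sum_sub_distrib, ← Finset.mul_sum]
      ring
    have i1 : IntegrableOn (fun x => h δ x * divMul f q x) Ω := by
      refine Integrable.bdd_mul hA (hh δ).continuous.aestronglyMeasurable (c := 1) ?_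
      refine Eventually.of_forall fun x => ?_
      rw [Real.norm_of_nonneg (Real.smoothTransition.nonneg _)]
      exact Real.smoothTransition.le_one _
    have i2 : IntegrableOn (fun x => q x * lam δ x * G x) Ω := by
      have h1 : ContinuousOn (fun x => q x * lam δ x * G x) (closure Ω) :=
        (hq.continuous.mul (hlamc δ)).continuousOn.mul hGc
      exact (h1.integrableOn_compact hΩ.isBounded.isCompact_closure).mono_set subset_closure
    simp only [e1] at h0
    rw [integral_sub i1 i2] at h0
    linarith
  -- as `δ → 0`, the cutoff tends to `1` on `Ω`, and the boundary term to `0`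
  have t1 : Tendsto (fun δ => ∫ x in Ω, h δ x * divMul f q x) (𝓝[>] 0)
      (𝓝 (∫ x in Ω, divMul f q x)) := by
    refine tendsto_integral_filter_of_dominated_convergence (fun x => |divMul f q x|) ?_ ?_
      hA.abs ?_
    · exact Eventually.of_forall fun δ =>
        (hh δ).continuous.aestronglyMeasurable.mul hA.aestronglyMeasurable
    · refine Eventually.of_forall fun δ => Eventually.of_forall fun x => ?_
      rw [Real.norm_eq_abs, abs_mul, abs_of_nonneg (Real.smoothTransition.nonneg _)]
      exact mul_le_of_le_one_left (abs_nonneg _) (Real.smoothTransition.le_one _)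
    · filter_upwards [ae_restrict_mem hΩm] with x hx
      by_cases hxq : x ∈ tsupport q
      · have hρx : ρ x < 0 := (hΩρ x (hqB hxq)).1 hx
        refine tendsto_const_nhds.congr' ?_
        filter_upwards [self_mem_nhdsWithin,
          mem_nhdsWithin_of_mem_nhds (gt_mem_nhds (show 0 < -ρ x / 2 by linarith))] with δ hδ hδ2
        have hδ : 0 < δ := hδ
        have : h δ x = 1 := Real.smoothTransition.one_of_one_le (by
          rw [le_sub_iff_add_le, le_div_iff₀ hδ]; linarith)
        rw [this, one_mul]
      · have : divMul f q x = 0 := by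
          simp [divMul, image_eq_zero_of_notMem_tsupport hxq,
            pderiv_eq_zero_of_notMem_tsupport hxq]
        simp [this]
  have t2 : Tendsto (fun δ => ∫ x in Ω, q x * lam δ x * G x) (𝓝[>] 0) (𝓝 0) := by
    rw [Metric.tendsto_nhds]
    intro ε hε
    obtain ⟨c, c0, hc⟩ := hsmall (ε * μ / (C * (I + 1))) (by positivity)
    filter_upwards [self_mem_nhdsWithin,
      mem_nhdsWithin_of_mem_nhds (gt_mem_nhds (show 0 < c / 2 by linarith))] with δ hδ hδ2
    have hδ : 0 < δ := hδ
    rw [dist_zero_right]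
    have h1 : ‖∫ x in Ω, q x * lam δ x * G x‖
        ≤ ∫ x in Ω, ε * μ / (I + 1) * (b x * lam δ x) := by
      refine norm_integral_le_of_norm_le ((hmassint δ).const_mul _).integrableOn ?_
      filter_upwards [ae_restrict_mem hΩm] with x hx
      rw [Real.norm_eq_abs, abs_mul, abs_mul, abs_of_nonneg (hlam0 δ hδ x)]
      have hbl := mul_nonneg (b.nonneg' x) (hlam0 δ hδ x)
      by_cases hxq : x ∈ tsupport q
      · rcases lt_or_ge (ρ x) (-(2 * δ)) with h2 | h2
        · rw [hlamz δ hδ x h2]; simp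
        · have h3 := hc x hxq (subset_closure hx) (by linarith)
          calc |q x| * lam δ x * |G x|
              ≤ C * b x * lam δ x * (ε * μ / (C * (I + 1))) := by
                have := hlam0 δ hδ x
                have := b.nonneg' x
                have := hqb x
                gcongr
            _ = ε * μ / (I + 1) * (b x * lam δ x) := by field_simp
      · rw [image_eq_zero_of_notMem_tsupport hxq, abs_zero, zero_mul, zero_mul]
        positivity
    have h2 : ∫ x in Ω, ε * μ / (I + 1) * (b x * lam δ x)
        ≤ ∫ x, ε * μ / (I + 1) * (b x * lam δ x) :=
      setIntegral_le_integral ((hmassint δ).const_mul _) (Eventually.of_forall fun x =>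
        mul_nonneg (by positivity) (mul_nonneg (b.nonneg' x) (hlam0 δ hδ x)))
    calc _ ≤ _ := h1
      _ ≤ _ := h2
      _ = ε / (I + 1) * (μ * ∫ x, b x * lam δ x) := by rw [integral_const_mul]; ring
      _ ≤ ε / (I + 1) * I := mul_le_mul_of_nonneg_left (hmass δ hδ) (by positivity)
      _ < ε := by
        rw [div_mul_eq_mul_div, div_lt_iff₀ (by positivity)]
        nlinarith
  refine tendsto_nhds_unique t1 (t2.congr' ?_)
  filter_upwards [self_mem_nhdsWithin] with δ hδ
  exact (hid δ hδ).symm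

/-- The divergence theorem on a bounded smooth domain, for a vector field that is `C¹` inside,
continuous up to the boundary and tangential there, with integrable divergence. -/
theorem integral_divergence_eq_zero (hΩ : IsBody Ω)
    (hf : ∀ j, ContDiffOn ℝ 1 (f j) Ω) (hfc : ∀ j, ContinuousOn (f j) (closure Ω))
    (hint : IntegrableOn (fun x => ∑ j, pderiv j (f j) x) Ω)
    (htr : ∀ p ν, IsOutwardUnitNormal Ω p ν → ∑ j, f j p * ν j = 0) :
    ∫ x in Ω, ∑ j, pderiv j (f j) x = 0 := by
  have hΩm : MeasurableSet Ω := hΩ.isOpen.measurableSet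
  have hK : IsCompact (closure Ω) := hΩ.isBounded.isCompact_closure
  have hloc : ∀ p : E3, ∃ r, 0 < r ∧ (p ∈ closure Ω → ∀ q : E3 → ℝ, ContDiff ℝ 1 q →
      tsupport q ⊆ Metric.ball p r → ∫ x in Ω, divMul f q x = 0) := by
    intro p
    by_cases hp : p ∈ Ω
    · obtain ⟨r, r0, hr⟩ := Metric.isOpen_iff.1 hΩ.isOpen p hp
      refine ⟨r, r0, fun _ q hq hqs => ?_⟩
      exact integral_divMul_of_tsupport_subset hΩ.isOpen hf hq
        ((isCompact_closedBall p r).of_isClosed_subset (isClosed_tsupport q)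
          (hqs.trans Metric.ball_subset_closedBall)) (hqs.trans hr)
    · by_cases hpc : p ∈ closure Ω
      · obtain ⟨r, r0, hr⟩ := exists_ball_integral_divMul_eq_zero hΩ hf hfc hint htr
          (p := p) ⟨hpc, fun h => hp (interior_subset h)⟩
        exact ⟨r, r0, fun _ => hr⟩
      · exact ⟨1, one_pos, fun h => absurd h hpc⟩
  choose r r0 hr using hloc
  let χ : ∀ p, ContDiffBump p := fun p => ⟨r p / 3, r p / 2, by have := r0 p; linarith,
    by have := r0 p; linarith⟩
  obtain ⟨t, htc, hcov⟩ := hK.elim_nhds_subcover (fun p => Metric.ball p (r p / 3))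
    fun p _ => Metric.ball_mem_nhds p (by have := r0 p; positivity)
  have hprodC : ∀ s : Finset E3, ContDiff ℝ 1 fun x => ∏ p ∈ s, (1 - χ p x) := fun s =>
    contDiff_prod fun p _ => contDiff_const.sub (χ p).contDiff
  have hint' := fun {q : E3 → ℝ} (hq : ContDiff ℝ 1 q) =>
    integrableOn_divMul hΩ.isBounded hΩm hfc hint hq
  -- multiplication by `1 - χ p` does not change the integral
  have hstep : ∀ p ∈ closure Ω, ∀ q : E3 → ℝ, ContDiff ℝ 1 q →
      ∫ x in Ω, divMul f (fun x => (1 - χ p x) * q x) x = ∫ x in Ω, divMul f q x := by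
    intro p hp q hq
    have hq2 : ContDiff ℝ 1 fun x => χ p x * q x := (χ p).contDiff.mul hq
    have hq1 : ContDiff ℝ 1 fun x => (1 - χ p x) * q x :=
      (contDiff_const.sub (χ p).contDiff).mul hq
    have h0 := hr p hp _ hq2 (by
      refine tsupport_mul_subset_left.trans ?_
      rw [(χ p).tsupport_eq]
      exact Metric.closedBall_subset_ball (show r p / 2 < r p by have := r0 p; linarith))
    have e : ∀ x, divMul f q x
        = divMul f (fun x => (1 - χ p x) * q x) x + divMul f (fun x => χ p x * q x) x := by
      intro x
      have hd1 : DifferentiableAt ℝ (χ p) x := ((χ p).contDiff (n := 1)).differentiable (by simp) x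
      have hd2 : DifferentiableAt ℝ q x := hq.differentiable (by simp) x
      have hd3 : ∀ j, pderiv j (fun x => 1 - χ p x) x = -pderiv j (χ p) x := fun j => by
        rw [pderiv, fderiv_const_sub]; rfl
      simp only [divMul, pderiv_mul hd1 hd2, pderiv_mul (hd1.const_sub 1) hd2, hd3]
      rw [add_add_add_comm, ← Finset.sum_add_distrib]
      congr 1
      · ring
      · exact Finset.sum_congr rfl fun j _ => by ring
    simp only [e]
    rw [integral_add (hint' hq1) (hint' hq2), h0, add_zero]
  have hprod : ∀ s : Finset E3, s ⊆ t →
      ∫ x in Ω, divMul f (fun x => ∏ p ∈ s, (1 - χ p x)) x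
        = ∫ x in Ω, divMul f (fun _ => 1) x := by
    classical
    intro s
    induction s using Finset.induction_on with
    | empty => intro _; simp
    | insert p s hps ih =>
      intro hst
      simp only [Finset.prod_insert hps]
      rw [hstep p (htc p (hst (Finset.mem_insert_self _ _))) _ (hprodC s)]
      exact ih fun y hy => hst (Finset.mem_insert_of_mem hy)
  -- after all factors are inserted, the test function vanishes in a neighbourhood of `Ω`
  have h1 : ∫ x in Ω, divMul f (fun _ => 1) x = ∫ x in Ω, ∑ j, pderiv j (f j) x := by
    simp [divMul, pderiv]
  rw [← h1, ← hprod t subset_rfl]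
  refine setIntegral_eq_zero_of_forall_eq_zero fun x hx => ?_
  obtain ⟨p, hp, hxp⟩ := mem_iUnion₂.1 (hcov (subset_closure hx))
  have hz : (fun x => ∏ p ∈ t, (1 - χ p x)) =ᶠ[𝓝 x] fun _ => 0 := by
    filter_upwards [Metric.isOpen_ball.mem_nhds hxp] with y hy
    refine Finset.prod_eq_zero hp ?_
    rw [(χ p).one_of_mem_closedBall (Metric.ball_subset_closedBall hy), sub_self]
  have hz0 := hz.eq_of_nhds
  simp only [divMul, hz0, pderiv, hz.fderiv_eq]
  simp

end Divergence

/-! ### Solutions of Giulini's equations -/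

section Solution

theorem laplacian_eq_sum_pderiv {φ : E3 → ℝ} (hφ : ContDiff ℝ ∞ φ) (x : E3) :
    (Δ φ) x = ∑ j, pderiv j (pderiv j φ) x := by
  rw [InnerProductSpace.laplacian_eq_iteratedFDeriv_orthonormalBasis φ
    (EuclideanSpace.basisFun (Fin 3) ℝ)]
  refine Finset.sum_congr rfl fun j _ => ?_
  have hd : DifferentiableAt ℝ (fderiv ℝ φ) x :=
    ((contDiff_infty.1 hφ 2).fderiv_right (m := 1) (by norm_num)).differentiable (by simp) x
  rw [iteratedFDeriv_two_apply]
  simp only [pderiv, EuclideanSpace.basisFun_apply, Matrix.cons_val_zero, Matrix.cons_val_one]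
  have : pderiv j φ = fun y => fderiv ℝ φ y (EuclideanSpace.single j 1) := rfl
  rw [this, fderiv_clm_apply hd (differentiableAt_const _)]
  simp

/-- Green's first identity for a `C¹` function and a smooth test function. -/
theorem integral_mul_laplacian {U φ : E3 → ℝ} (hU : ContDiff ℝ 1 U) (hφ : ContDiff ℝ ∞ φ)
    (hc : HasCompactSupport φ) :
    ∫ x, U x * (Δ φ) x = -∫ x, fderiv ℝ φ x (gradient U x) := by
  have hp : ∀ j, ContDiff ℝ 1 (pderiv j φ) := fun j =>
    ((contDiff_infty.1 hφ 2).fderiv_right (m := 1) (by norm_num)).clm_apply contDiff_const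
  have hpc : ∀ j, HasCompactSupport (pderiv j φ) := fun j => hasCompactSupport_pderiv hc j
  have e1 : ∀ x, U x * (Δ φ) x = ∑ j, U x * pderiv j (pderiv j φ) x := fun x => by
    rw [laplacian_eq_sum_pderiv hφ, Finset.mul_sum]
  have e2 : ∀ x, fderiv ℝ φ x (gradient U x) = ∑ j, pderiv j φ x * pderiv j U x := fun x => by
    rw [fderiv_apply_eq_sum_pderiv]
    exact Finset.sum_congr rfl fun j _ => by rw [pderiv_eq_gradient U, mul_comm]
  have i1 : ∀ j, Integrable fun x => U x * pderiv j (pderiv j φ) x := fun j =>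
    (hU.continuous.mul (continuous_pderiv (hp j) j)).integrable_of_hasCompactSupport
      (hasCompactSupport_pderiv (hpc j) j).mul_left
  have i2 : ∀ j, Integrable fun x => pderiv j φ x * pderiv j U x := fun j =>
    ((hp j).continuous.mul (continuous_pderiv hU j)).integrable_of_hasCompactSupport
      (hpc j).mul_right
  simp only [e1, e2]
  rw [integral_finsetSum _ fun j _ => i1 j, integral_finsetSum _ fun j _ => i2 j,
    ← Finset.sum_neg_distrib]
  exact Finset.sum_congr rfl fun j _ => integral_mul_fderiv_eq_neg hU (hp j) (hpc j) _

/-- The total energy density of the bodies. -/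
def totalDensity {N : ℕ} (Ω : Fin N → Set E3) (ε : Fin N → E3 → ℝ) (x : E3) : ℝ :=
  ∑ α, (Ω α).indicator (ε α) x

/-- The function `ψ = exp (U / (2c²))`, in terms of which the field equation is linear. -/
def expPotential (c : ℝ) (U : E3 → ℝ) (x : E3) : ℝ := Real.exp (U x / (2 * c ^ 2))

/-- The source of the linear equation `Δψ = (2πG/c⁴) ε ψ`. -/
def source (G c : ℝ) {N : ℕ} (Ω : Fin N → Set E3) (ε : Fin N → E3 → ℝ) (U : E3 → ℝ)
    (x : E3) : ℝ :=
  2 * Real.pi * G / c ^ 4 * (totalDensity Ω ε x * expPotential c U x)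

theorem contDiff_expPotential (c : ℝ) {U : E3 → ℝ} (hU : ContDiff ℝ 1 U) :
    ContDiff ℝ 1 (expPotential c U) := (hU.div_const _).exp

theorem fderiv_expPotential (c : ℝ) {U : E3 → ℝ} (hU : ContDiff ℝ 1 U) (x v : E3) :
    fderiv ℝ (expPotential c U) x v
      = expPotential c U x / (2 * c ^ 2) * fderiv ℝ U x v := by
  have h : HasFDerivAt (fun y => U y / (2 * c ^ 2)) ((2 * c ^ 2)⁻¹ • fderiv ℝ U x) x := by
    simpa only [div_eq_mul_inv] using
      (hU.differentiable (by simp) x).hasFDerivAt.mul_const (2 * c ^ 2)⁻¹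
  rw [show fderiv ℝ (expPotential c U) x = _ from h.exp.fderiv]
  simp only [smul_apply, smul_eq_mul, expPotential]
  ring

theorem expPotential_sq {c : ℝ} (hc : 0 < c) (U : E3 → ℝ) (x : E3) :
    expPotential c U x * expPotential c U x = Real.exp (U x / c ^ 2) := by
  rw [expPotential, ← Real.exp_add]
  congr 1
  field_simp
  norm_num

variable {G c : ℝ} {N : ℕ} {Ω : Fin N → Set E3} {ε : Fin N → E3 → ℝ}
  {σ : Fin N → E3 → Matrix (Fin 3) (Fin 3) ℝ} {U : E3 → ℝ}

theorem IsSolution.integrable_totalDensity (h : IsSolution G c Ω ε σ U) :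
    Integrable (totalDensity Ω ε) :=
  integrable_finsetSum _ fun α _ =>
    (integrable_indicator_iff (h.isBody α).isOpen.measurableSet).2 (h.density_integrable α)

theorem IsSolution.totalDensity_nonneg (h : IsSolution G c Ω ε σ U) (x : E3) :
    0 ≤ totalDensity Ω ε x :=
  Finset.sum_nonneg fun α _ => indicator_nonneg (fun y hy => (h.density_pos α y hy).le) x

theorem IsSolution.tendsto_expPotential (h : IsSolution G c Ω ε σ U) :
    Tendsto (expPotential c U) (cocompact E3) (𝓝 1) := by
  have := (h.tendsto_zero.div_const (2 * c ^ 2)).rexp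
  rwa [zero_div, Real.exp_zero] at this

theorem IsSolution.integrable_source (h : IsSolution G c Ω ε σ U) :
    Integrable (source G c Ω ε U) := by
  obtain ⟨C, -, hC⟩ := exists_bound_of_tendsto_cocompact
    (contDiff_expPotential c h.contDiff).continuous h.tendsto_expPotential
  exact (h.integrable_totalDensity.mul_bdd
    (contDiff_expPotential c h.contDiff).continuous.aestronglyMeasurable
    (Eventually.of_forall hC)).const_mul _

theorem IsSolution.source_nonneg (hG : 0 < G) (hc : 0 < c) (h : IsSolution G c Ω ε σ U)
    (x : E3) : 0 ≤ source G c Ω ε U x := by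
  have h1 := h.totalDensity_nonneg x
  have h2 : 0 < expPotential c U x := Real.exp_pos _
  have := Real.pi_pos
  unfold source
  positivity

theorem IsSolution.exists_source_eq_zero (h : IsSolution G c Ω ε σ U) :
    ∃ R, ∀ x, R ≤ ‖x‖ → source G c Ω ε U x = 0 := by
  have hb : Bornology.IsBounded (⋃ α, Ω α) :=
    (Bornology.isBounded_iUnion).2 fun α => (h.isBody α).isBounded
  obtain ⟨R, hR⟩ := hb.subset_ball (0 : E3)
  refine ⟨R, fun x hx => ?_⟩
  have h0 : totalDensity Ω ε x = 0 := Finset.sum_eq_zero fun α _ => by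
    refine indicator_of_notMem (fun hxα => ?_) _
    have := hR (mem_iUnion.2 ⟨α, hxα⟩)
    rw [mem_ball_zero_iff] at this
    linarith
  simp [source, h0]

/-- The field equation becomes `Δψ = (2πG/c⁴) ε ψ`: test it with `ψ χ`. -/
theorem IsSolution.isWeakPoisson (hc : 0 < c) (h : IsSolution G c Ω ε σ U) :
    IsWeakPoisson (expPotential c U) (source G c Ω ε U) := by
  intro χ hχ hχc
  have hU := h.contDiff
  set ψ := expPotential c U with hψdef
  have hψ : ContDiff ℝ 1 ψ := contDiff_expPotential c hU
  set k := 4 * Real.pi * G / c ^ 2 with hk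
  let F : E3 → ℝ := fun x =>
    -(k * totalDensity Ω ε x - 1 / (2 * c ^ 2) * ‖gradient U x‖ ^ 2)
  have hGc : Continuous fun x => 1 / (2 * c ^ 2) * ‖gradient U x‖ ^ 2 :=
    continuous_const.mul ((continuous_gradient hU).norm.pow 2)
  have hρ : Integrable fun x => k * totalDensity Ω ε x :=
    h.integrable_totalDensity.const_mul k
  have hF : LocallyIntegrable F := (hρ.locallyIntegrable.sub hGc.locallyIntegrable).neg
  have hsm : ∀ φ : E3 → ℝ, ContDiff ℝ ∞ φ → HasCompactSupport φ →
      ∫ x, fderiv ℝ φ x (gradient U x) = ∫ x, F x * φ x := by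
    intro φ hφ hφc
    have h1 := h.field φ hφ hφc
    rw [integral_mul_laplacian hU hφ hφc] at h1
    have e : ∀ x, F x * φ x = -((4 * Real.pi * G / c ^ 2 * (∑ α, (Ω α).indicator (ε α) x)
        - 1 / (2 * c ^ 2) * ‖gradient U x‖ ^ 2) * φ x) := fun x => by
      simp only [F, totalDensity, hk]; ring
    simp only [e]
    rw [integral_neg]
    linarith
  have hψχ : ContDiff ℝ 1 fun x => ψ x * χ x := hψ.mul hχ
  have h1 := weak_identity_of_smooth (continuous_gradient hU) hF hsm hψχ hχc.mul_left
  have hc2 : (2 * c ^ 2) ≠ 0 := by positivity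
  have e1 : ∀ x, fderiv ℝ (fun x => ψ x * χ x) x (gradient U x)
      = 2 * c ^ 2 * fderiv ℝ χ x (gradient ψ x)
        + 1 / (2 * c ^ 2) * ‖gradient U x‖ ^ 2 * (ψ x * χ x) := by
    intro x
    rw [fderiv_fun_mul (hψ.differentiable (by simp) x) (hχ.differentiable (by simp) x),
      fderiv_gradient_comm χ ψ]
    simp only [add_apply, smul_apply, smul_eq_mul, hψdef, fderiv_expPotential c hU,
      fderiv_gradient_self, fderiv_gradient_comm U χ]
    field_simp
  have e2 : ∀ x, F x * (ψ x * χ x)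
      = -(2 * c ^ 2) * (source G c Ω ε U x * χ x)
        + 1 / (2 * c ^ 2) * ‖gradient U x‖ ^ 2 * (ψ x * χ x) := by
    intro x
    have : k = 2 * c ^ 2 * (2 * Real.pi * G / c ^ 4) := by rw [hk]; field_simp; ring
    simp only [F, source, ← hψdef, this]
    ring
  simp only [e1, e2] at h1
  have i1 : Integrable fun x => 2 * c ^ 2 * fderiv ℝ χ x (gradient ψ x) :=
    ((continuous_fderiv_gradient hχ hψ).integrable_of_hasCompactSupport
      ((hχc.fderiv (𝕜 := ℝ)).mono fun x hx hx' => hx (by simp [hx']))).const_mul _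
  have i2 : Integrable fun x => 1 / (2 * c ^ 2) * ‖gradient U x‖ ^ 2 * (ψ x * χ x) :=
    (hGc.mul hψχ.continuous).integrable_of_hasCompactSupport hχc.mul_left.mul_left
  have i3 : Integrable fun x => -(2 * c ^ 2) * (source G c Ω ε U x * χ x) :=
    (h.integrable_source.locallyIntegrable.integrable_smul_right_of_hasCompactSupport
      hχ.continuous hχc).const_mul _
  rw [integral_add i1 i2, integral_add i3 i2, integral_const_mul, integral_const_mul] at h1
  have h2 : 2 * c ^ 2 * ((∫ x, fderiv ℝ χ x (gradient ψ x))
      + ∫ x, source G c Ω ε U x * χ x) = 0 := by linarith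
  have h3 := (mul_eq_zero.1 h2).resolve_left hc2
  linarith

theorem IsSolution.integrableOn_force (h : IsSolution G c Ω ε σ U) (α : Fin N) (v : E3) :
    IntegrableOn (fun x => ε α x * (expPotential c U x * fderiv ℝ (expPotential c U) x v))
      (Ω α) := by
  have hψ := contDiff_expPotential c h.contDiff
  have hcont : Continuous fun x => expPotential c U x * fderiv ℝ (expPotential c U) x v :=
    hψ.continuous.mul (continuous_fderiv_const hψ v)
  obtain ⟨C, -, hC⟩ := exists_pos_bound_on_compact (h.isBody α).isBounded.isCompact_closure
    hcont.continuousOn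
  refine Integrable.mul_bdd (h.density_integrable α) hcont.aestronglyMeasurable (c := C) ?_
  exact (ae_restrict_mem (h.isBody α).isOpen.measurableSet).mono
    fun x hx => hC x (subset_closure hx)

/-- The total gravitational force on each body vanishes: the force density is the divergence of
the rescaled stress `exp (U / c²) σ`, which exerts no traction on the boundary. -/
theorem IsSolution.integral_force_eq_zero (hc : 0 < c) (h : IsSolution G c Ω ε σ U)
    (α : Fin N) (v : E3) :
    ∫ x in Ω α, ε α x * (expPotential c U x * fderiv ℝ (expPotential c U) x v) = 0 := by
  have hU := h.contDiff
  have hm := h.matter α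
  have hΩ := h.isBody α
  have hi : ∀ i : Fin 3,
      ∫ x in Ω α, ε α x * (expPotential c U x * pderiv i (expPotential c U) x) = 0 := by
    intro i
    let f : Fin 3 → E3 → ℝ := fun j y => Real.exp (U y / c ^ 2) * σ α y i j
    have hexp : ContDiff ℝ 1 fun y => Real.exp (U y / c ^ 2) := (hU.div_const _).exp
    have e : ∀ x ∈ Ω α, ∑ j, pderiv j (f j) x
        = 2 * (ε α x * (expPotential c U x * pderiv i (expPotential c U) x)) := by
      intro x hx
      have hb := hm.balance x hx i
      have h1 : ∑ j, pderiv j (f j) x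
          = Real.exp (U x / c ^ 2) * (1 / c ^ 2 * ε α x * pderiv i U x) := by
        rw [← hb, ← mul_assoc, ← Real.exp_add, add_neg_cancel, Real.exp_zero, one_mul]
      rw [h1, ← expPotential_sq hc, pderiv, pderiv, fderiv_expPotential c hU]
      field_simp
    have hint : IntegrableOn (fun x => ∑ j, pderiv j (f j) x) (Ω α) :=
      IntegrableOn.congr_fun ((h.integrableOn_force α _).const_mul 2) (fun x hx => (e x hx).symm)
        hΩ.isOpen.measurableSet
    have h0 := integral_divergence_eq_zero hΩ (f := f)
      (fun j => hexp.contDiffOn.mul (hm.contDiffOn i j))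
      (fun j => hexp.continuous.continuousOn.mul (hm.continuousOn i j)) hint
      (fun p ν hν => by
        have := hm.traction p ν hν i
        simp only [f, mul_assoc, ← Finset.mul_sum, this, mul_zero])
    rw [setIntegral_congr_fun hΩ.isOpen.measurableSet e, integral_const_mul] at h0
    linarith
  have e : ∀ x, ε α x * (expPotential c U x * fderiv ℝ (expPotential c U) x v)
      = ∑ i, v i * (ε α x * (expPotential c U x * pderiv i (expPotential c U) x)) := by
    intro x
    rw [fderiv_apply_eq_sum_pderiv, Finset.mul_sum, Finset.mul_sum]
    exact Finset.sum_congr rfl fun i _ => by ring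
  simp only [e]
  have hint : ∀ i : Fin 3, IntegrableOn
      (fun x => v i * (ε α x * (expPotential c U x * pderiv i (expPotential c U) x))) (Ω α) :=
    fun i => (h.integrableOn_force α _).const_mul (v i)
  rw [integral_finsetSum _ fun i _ => hint i]
  exact Finset.sum_eq_zero fun i _ => by rw [integral_const_mul, hi i, mul_zero]

/-- A body that misses the plane lies on one side of it, so the total force on the matter in the
half-space is a sum of forces on whole bodies. -/
theorem IsSolution.integral_halfSpace_force_eq_zero (hc : 0 < c) (h : IsSolution G c Ω ε σ U)
    {a n : E3} (hdisj : ∀ α, Disjoint (plane a n) (Ω α)) :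
    ∫ x in {x | 0 < height a n x},
      source G c Ω ε U x * fderiv ℝ (expPotential c U) x n = 0 := by
  have hΩm : ∀ α, MeasurableSet (Ω α) := fun α => (h.isBody α).isOpen.measurableSet
  have e : ∀ x, source G c Ω ε U x * fderiv ℝ (expPotential c U) x n
      = ∑ α, 2 * Real.pi * G / c ^ 4 * (Ω α).indicator
        (fun x => ε α x * (expPotential c U x * fderiv ℝ (expPotential c U) x n)) x := by
    intro x
    rw [source, totalDensity, Finset.sum_mul, Finset.mul_sum, Finset.sum_mul]
    refine Finset.sum_congr rfl fun α _ => ?_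
    by_cases hx : x ∈ Ω α
    · simp only [indicator_of_mem hx]; ring
    · simp only [indicator_of_notMem hx]; ring
  simp only [e]
  have hi : ∀ α, Integrable ((Ω α).indicator
      fun x => ε α x * (expPotential c U x * fderiv ℝ (expPotential c U) x n)) := fun α =>
    (integrable_indicator_iff (hΩm α)).2 (h.integrableOn_force α n)
  rw [integral_finsetSum _ fun α _ => ((hi α).const_mul _).integrableOn]
  refine Finset.sum_eq_zero fun α _ => ?_
  rw [integral_const_mul, setIntegral_indicator (hΩm α)]
  have hne : ∀ x ∈ Ω α, height a n x ≠ 0 := fun x hx h0 =>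
    disjoint_left.1 (hdisj α) (show x ∈ plane a n from h0) hx
  have hside : {x | 0 < height a n x} ∩ Ω α = Ω α ∨ {x | 0 < height a n x} ∩ Ω α = ∅ := by
    by_cases hex : ∃ x ∈ Ω α, 0 < height a n x
    · obtain ⟨x, hx, hxp⟩ := hex
      refine Or.inl (inter_eq_right.2 fun y hy => ?_)
      by_contra hcon
      have hyn : height a n y ≤ 0 := not_lt.1 hcon
      obtain ⟨z, hz, hz0⟩ := (h.isBody α).isConnected.isPreconnected.intermediate_value hy hx
        (contDiff_height (k := 0)).continuous.continuousOn ⟨hyn, hxp.le⟩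
      exact hne z hz hz0
    · push Not at hex
      exact Or.inr (eq_empty_of_forall_notMem fun x hx => (hex x hx.2).not_gt hx.1)
  rcases hside with hs | hs
  · rw [hs, h.integral_force_eq_zero hc α n, mul_zero]
  · rw [hs, setIntegral_empty, mul_zero]

theorem finrank_E3 : Module.finrank ℝ E3 = 3 := by simp

/-- The claim on the side of the plane to which `n` points. -/
theorem IsSolution.expPotential_eq_one (hG : 0 < G) (hc : 0 < c) (h : IsSolution G c Ω ε σ U)
    {a n : E3} (hn : ‖n‖ = 1) (hdisj : ∀ α, Disjoint (plane a n) (Ω α))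
    (hnormal : ∀ x ∈ plane a n, fderiv ℝ U x n = 0) {x : E3} (hx : 0 ≤ height a n x) :
    expPotential c U x = 1 := by
  have hψ := contDiff_expPotential c h.contDiff
  have hw := h.isWeakPoisson hc
  obtain ⟨R, hR⟩ := h.exists_source_eq_zero
  have hgrad : ∀ y, height a n y = 0 → gradient (expPotential c U) y = 0 := fun y hy =>
    hw.gradient_eq_zero_on_plane finrank_E3 hψ h.tendsto_expPotential
      h.integrable_source.locallyIntegrable hR hn
      (fun z hz => by rw [fderiv_expPotential c h.contDiff, hnormal z hz, mul_zero])
      (h.integral_halfSpace_force_eq_zero hc hdisj) hy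
  have hone : ∀ y, height a n y = 0 → expPotential c U y = 1 := fun y hy =>
    eq_one_on_plane finrank_E3 hψ h.tendsto_expPotential hgrad hy
  rcases hx.eq_or_lt with h0 | h0
  · exact hone x h0.symm
  · exact hw.eq_one_of_cauchy_data finrank_E3 hψ h.tendsto_expPotential (h.source_nonneg hG hc)
      hn hone hgrad h0

/-- Positive energy density is a nonzero source, so a solution with `ψ = 1` has no bodies. -/
theorem IsSolution.eq_zero_of_expPotential_eq_one (hG : 0 < G) (hc : 0 < c)
    (h : IsSolution G c Ω ε σ U) (hψ1 : ∀ x, expPotential c U x = 1) : N = 0 := by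
  by_contra hN
  let α : Fin N := ⟨0, Nat.pos_of_ne_zero hN⟩
  obtain ⟨p, hp⟩ := (h.isBody α).isConnected.nonempty
  have hχ := contDiff_radialBump p 1
  have hχc := hasCompactSupport_radialBump p zero_le_one
  have h1 := h.isWeakPoisson hc _ hχ hχc
  have hgrad : ∀ x, gradient (expPotential c U) x = 0 := fun x => by
    rw [funext hψ1]; exact gradient_fun_const x 1
  simp only [hgrad, map_zero, integral_zero] at h1
  have hi : Integrable fun x => source G c Ω ε U x * radialBump p 1 x :=
    h.integrable_source.locallyIntegrable.integrable_smul_right_of_hasCompactSupport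
      hχ.continuous hχc
  have h2 := (integral_eq_zero_iff_of_nonneg
    (fun x => mul_nonneg (h.source_nonneg hG hc x) (radialBump_nonneg p 1 x)) hi).1
    (by linarith)
  have h3 : (Ω α ∩ Metric.ball p 1) ⊆
      {x | ¬(source G c Ω ε U x * radialBump p 1 x = (0 : E3 → ℝ) x)} := by
    rintro x ⟨hx, hxb⟩
    have hρ : 0 < totalDensity Ω ε x :=
      Finset.sum_pos' (fun β _ => indicator_nonneg (fun y hy => (h.density_pos β y hy).le) x)
        ⟨α, Finset.mem_univ _, by rw [indicator_of_mem hx]; exact h.density_pos α x hx⟩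
    have hb : 0 < radialBump p 1 x := radialBump_pos (by rwa [← dist_eq_norm])
    have := Real.pi_pos
    have hs : 0 < source G c Ω ε U x := by
      rw [source, hψ1]; positivity
    exact (mul_pos hs hb).ne'
  have h4 : volume (Ω α ∩ Metric.ball p 1) = 0 := measure_mono_null h3 (ae_iff.1 h2)
  exact (((h.isBody α).isOpen.inter Metric.isOpen_ball).measure_pos volume
    ⟨p, hp, Metric.mem_ball_self one_pos⟩).ne' h4

end Solution

end Giulini

end

theorem mainTheorem3 (G c : ℝ) (hG : 0 < G) (hc : 0 < c) (N : ℕ)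
    (Ω : Fin N → Set Giulini.E3) (ε : Fin N → Giulini.E3 → ℝ)
    (σ : Fin N → Giulini.E3 → Matrix (Fin 3) (Fin 3) ℝ) (U : Giulini.E3 → ℝ)
    (hsol : Giulini.IsSolution G c Ω ε σ U)
    (a n : Giulini.E3) (hn : ‖n‖ = 1)
    (hdisj : ∀ α, Disjoint (Giulini.plane a n) (Ω α))
    (hnormal : ∀ x ∈ Giulini.plane a n, fderiv ℝ U x n = 0) :
    N = 0 ∧ ∀ x, U x = 0 := by
  have hψ : ∀ x, Giulini.expPotential c U x = 1 := by
    intro x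
    rcases le_total 0 (Giulini.height a n x) with hx | hx
    · exact hsol.expPotential_eq_one hG hc hn hdisj hnormal hx
    · -- on the other side, use the opposite unit normal of the same plane
      have hpl : Giulini.plane a (-n) = Giulini.plane a n := by
        ext y
        simp [Giulini.plane, inner_neg_left]
      refine hsol.expPotential_eq_one hG hc (a := a) (n := -n) (by rwa [norm_neg])
        (fun α => by rw [hpl]; exact hdisj α) (fun y hy => ?_) ?_
      · rw [map_neg, hnormal y (hpl ▸ hy), neg_zero]
      · simpa [Giulini.height, inner_neg_left] using hx
  refine ⟨hsol.eq_zero_of_expPotential_eq_one hG hc hψ, fun x => ?_⟩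
  have h := hψ x
  rw [Giulini.expPotential, Real.exp_eq_one_iff, div_eq_zero_iff] at h
  exact h.resolve_right (by positivity)
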